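/- Let $k$ be a field, $n\ge 1$ and $m\ge 0$, and let $I=\{1,\dots,n\}$, where all indices have the same parity (all even or all odd). If they are odd, assume $\operatorname{char}k\neq 2$. Let $\mathfrak C_I$ be the $k$-algebra generated by $\mathfrak c_1,\dots,\mathfrak c_n$ with $\mathfrak c_i\mathfrak c_j=-\mathfrak c_j\mathfrak c_i$ $(i\ne j)$ and $\mathfrak c_i^2=1$ if the indices are odd, and $\mathfrak c_i=0$ for all $i$ (so $\mathfrak C_I=k$) if they are even. Let $s_i$ be the transposition $(i,i+1)$. * $\mathrm{Pol}\mathfrak C_I$ is generated over $\mathfrak C_I$ by commuting $y_1,\dots,y_n$ with $y_i\mathfrak c_j=(-1)^{\delta_{ij}}\mathfrak c_jy_i$. The transposition $s_i$ acts on it by permuting the $y$'s and the $\mathfrak c$'s. For $1\le i<n$ the operator $\mathfrak d_i$ on it is the $k$-linear map with $\mathfrak d_i(fg)=\mathfrak d_i(f)g+s_i(f)\mathfrak d_i(g)$, $\mathfrak d_i(\mathfrak c_j)=0$, $\mathfrak d_i(y_i)=-1-\mathfrak c_i\mathfrak c_{i+1}$, $\mathfrak d_i(y_{i+1})=1-\mathfrak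 c_i\mathfrak c_{i+1}$, and $\mathfrak d_i(y_j)=0$ otherwise. Put $\Lambda\mathrm{Pol}\mathfrak C_I=\bigcap_{i=1}^{n-1}\ker\mathfrak d_i$. * $\mathsf{NH}\mathfrak C_n$ is the $k$-algebra generated by $y_i,\mathfrak c_i$ $(1\le i\le n)$ and $\mathfrak d_i$ $(1\le i<n)$ with the above relations between the $y$'s and $\mathfrak c$'s, and with $\mathfrak d_iy_j-y_{s_i(j)}\mathfrak d_i=-1-\mathfrak c_i\mathfrak c_{i+1}$, $\,1-\mathfrak c_i\mathfrak c_{i+1}$, $\,0$ for $j=i$, $\,j=i+1$, $\,j\neq i,i+1$ respectively, $\mathfrak d_i\mathfrak c_j=\mathfrak c_{s_i(j)}\mathfrak d_i$, $\mathfrak d_i^2=0$, $\mathfrak d_i\mathfrak d_j=\mathfrak d_j\mathfrak d_i$ for $|i-j|>1$, and $\mathfrak d_i\mathfrak d_{i+1}\mathfrak d_i=\mathfrak d_{i+1}\mathfrak d_i\mathfrak d_{i+1}$. * Put $\gamma_{i,i\pm1}=\pm\mathfrak c_i$ if the indices are odd (including $\gamma_{n,n+1}=\mathfrak c_n$) and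 $\gamma_{i,i\pm1}=1$ if they are even. Put $\kappa_{b,b}=\gamma_{b,b+1}$ and, for $a<b$, $\kappa_{a,b}=\Bigl(\prod_{j=a+1}^{b-1}\gamma_{j,j-1}\gamma_{j,j+1}\Bigr)\gamma_{b,b-1}$ (factors in increasing order of $j$), and $\tilde\kappa_{a,b}=\kappa_{a,b}\kappa_{b,b}$. * Define $\mathfrak e^{(j)}_0=1$, $\mathfrak e^{(j)}_r=0$ for $r>j$, and $\mathfrak e^{(j)}_r=\mathfrak e^{(j-1)}_r+\mathfrak e^{(j-1)}_{r-1}\kappa_{r,j}y_j$ for $1\le r\le j\le n$. Let $M_{(n)}$ be the $n\times n$ matrix with first column $\bigl(\mathfrak e^{(n)}_1,-\mathfrak e^{(n)}_2,\dots,(-1)^{n-1}\mathfrak e^{(n)}_n\bigr)^T$, superdiagonal $(\tilde\kappa_{1,2},\dots,\tilde\kappa_{1,n})$ and all other entries $0$, and let $h^{(n)}_r$ be the top left entry of $M_{(n)}^r$ $(r\ge 0)$. Then all $h^{(n)}_r$ lie in $\Lambda\mathrm{Pol}\mathfrak C_I$. Let $$\mathsf{NH}\mathfrak C_n^m=\mathsf{NH}\mathfrak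 C_n/\bigl((\kappa_{1,n}y_n)^m\bigr),\qquad H\mathfrak C_{(m,n)}=\Lambda\mathrm{Pol}\mathfrak C_I/\bigl(h^{(n)}_r\bigr)_{r\ge 0,\ r>m-n}$$ be the quotients by the two-sided ideals generated by the indicated elements. Then $\mathsf{NH}\mathfrak C_n^m$ and $H\mathfrak C_{(m,n)}$ are Morita equivalent (as $k$-algebras); moreover $\mathsf{NH}\mathfrak C_n^m\cong\mathrm{Mat}_{n!}\bigl(H\mathfrak C_{(m,n)}\bigr)$ as $k$-algebras. -/

import Mathlib

universe u v

namespace CliffordNilHecke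

/-- Position `i` of the pair of neighbours `(i, i+1)`. Indices run through `Fin n`, that is, they are
shifted by one against the convention `1, …, n`. -/
def lo {n : ℕ} (i : Fin (n - 1)) : Fin n := ⟨i.1, by omega⟩

/-- Position `i + 1` of the pair of neighbours `(i, i+1)`. -/
def hi {n : ℕ} (i : Fin (n - 1)) : Fin n := ⟨i.1 + 1, by omega⟩

/-- The simple transposition `s_i = (i, i+1)`. -/
def simpleSwap {n : ℕ} (i : Fin (n - 1)) : Equiv.Perm (Fin n) := Equiv.swap (lo i) (hi i)

/-- The last index. -/
def lastIdx (n : ℕ) [NeZero n] : Fin n := ⟨n - 1, Nat.sub_one_lt (NeZero.ne n)⟩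

section Units

/-! The scalars `γ` and `κ`, formed from a family `c` of Clifford generators in any ring.
The parity of an index is `p i : ZMod 2`; odd means `p i = 1`. -/

variable {n : ℕ} {A : Type v} [Ring A] (p : Fin n → ZMod 2) (c : Fin n → A)

/-- `γ_{i,i+1}`: equal to `c_i` if `i` and `i + 1` are both odd, and `1` otherwise. For the last
index the condition on `i + 1` is void, so that `γ_{n,n+1}` is `c_n` if `n` is odd. -/
def gammaUp (i : Fin n) : A :=
  if p i = 1 ∧ ∀ j : Fin n, j.1 = i.1 + 1 → p j = 1 then c i else 1

/-- `γ_{i,i-1}`: equal to `-c_i` if `i` and `i - 1` are both odd, and `1` otherwise. -/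
def gammaDown (i : Fin n) : A :=
  if p i = 1 ∧ ∀ j : Fin n, j.1 + 1 = i.1 → p j = 1 then -c i else 1

/-- `κ_{a,b}` for `a ≤ b`: `κ_{b,b} = γ_{b,b+1}`, and for `a < b` the ordered product
`(γ_{a+1,a} γ_{a+1,a+2}) ⋯ (γ_{b-1,b-2} γ_{b-1,b}) γ_{b,b-1}`. -/
def kappa (a b : Fin n) : A :=
  if a = b then gammaUp p c b
  else (((List.finRange n).filter (fun j => a < j ∧ j < b)).map
    (fun j => gammaDown p c j * gammaUp p c j)).prod * gammaDown p c b

/-- `κ̃_{a,b} = κ_{a,b} κ_{b,b}`. -/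
def kappaTilde (a b : Fin n) : A := kappa p c a b * kappa p c b b

end Units

/-! ### The polynomial Clifford algebra -/

/-- Generators of the polynomial Clifford algebra. -/
inductive PolGen (n : ℕ) : Type
  | y (i : Fin n)
  | c (i : Fin n)

section Pol

variable (k : Type u) [Field k] {n : ℕ} (p : Fin n → ZMod 2)

/-- Defining relations of the polynomial Clifford algebra. The Clifford generators of even indices
are set to `0`; the others square to `1`. -/
inductive PolRel : FreeAlgebra k (PolGen n) → FreeAlgebra k (PolGen n) → Prop
  | c_even (i : Fin n) : p i = 0 → PolRel (FreeAlgebra.ι k (.c i)) 0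
  | c_sq (i : Fin n) : p i = 1 → PolRel (FreeAlgebra.ι k (.c i) * FreeAlgebra.ι k (.c i)) 1
  | c_anti (i j : Fin n) : i ≠ j →
      PolRel (FreeAlgebra.ι k (.c i) * FreeAlgebra.ι k (.c j))
        (-(FreeAlgebra.ι k (.c j) * FreeAlgebra.ι k (.c i)))
  | y_comm (i j : Fin n) :
      PolRel (FreeAlgebra.ι k (.y i) * FreeAlgebra.ι k (.y j))
        (FreeAlgebra.ι k (.y j) * FreeAlgebra.ι k (.y i))
  | y_c_same (i : Fin n) :
      PolRel (FreeAlgebra.ι k (.y i) * FreeAlgebra.ι k (.c i))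
        (-(FreeAlgebra.ι k (.c i) * FreeAlgebra.ι k (.y i)))
  | y_c (i j : Fin n) : i ≠ j →
      PolRel (FreeAlgebra.ι k (.y i) * FreeAlgebra.ι k (.c j))
        (FreeAlgebra.ι k (.c j) * FreeAlgebra.ι k (.y i))

/-- The polynomial Clifford algebra. -/
def PolC : Type u := RingQuot (PolRel k p)

noncomputable instance : Ring (PolC k p) := inferInstanceAs (Ring (RingQuot (PolRel k p)))

noncomputable instance : Algebra k (PolC k p) :=
  inferInstanceAs (Algebra k (RingQuot (PolRel k p)))

/-- The projection from the free algebra. -/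
noncomputable def polMk : FreeAlgebra k (PolGen n) →ₐ[k] PolC k p :=
  RingQuot.mkAlgHom k (PolRel k p)

/-- The indeterminate `y_i`. -/
noncomputable def polY (i : Fin n) : PolC k p := polMk k p (FreeAlgebra.ι k (.y i))

/-- The Clifford generator `c_i`. -/
noncomputable def polC (i : Fin n) : PolC k p := polMk k p (FreeAlgebra.ι k (.c i))

variable {k p}

theorem polMk_rel {a b : FreeAlgebra k (PolGen n)} (h : PolRel k p a b) :
    polMk k p a = polMk k p b :=
  RingQuot.mkAlgHom_rel k h

theorem polC_even {i : Fin n} (h : p i = 0) : polC k p i = 0 := by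
  have := polMk_rel (PolRel.c_even (k := k) (p := p) i h)
  simpa [polC] using this

theorem polC_sq {i : Fin n} (h : p i = 1) : polC k p i * polC k p i = 1 := by
  have := polMk_rel (PolRel.c_sq (k := k) (p := p) i h)
  simpa [polC] using this

theorem polC_anti {i j : Fin n} (h : i ≠ j) :
    polC k p i * polC k p j = -(polC k p j * polC k p i) := by
  have := polMk_rel (PolRel.c_anti (k := k) (p := p) i j h)
  simpa [polC] using this

theorem polY_comm (i j : Fin n) : polY k p i * polY k p j = polY k p j * polY k p i := by
  have := polMk_rel (PolRel.y_comm (k := k) (p := p) i j)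
  simpa [polY] using this

theorem polY_polC_same (i : Fin n) : polY k p i * polC k p i = -(polC k p i * polY k p i) := by
  have := polMk_rel (PolRel.y_c_same (k := k) (p := p) i)
  simpa [polY, polC] using this

theorem polY_polC {i j : Fin n} (h : i ≠ j) : polY k p i * polC k p j = polC k p j * polY k p i := by
  have := polMk_rel (PolRel.y_c (k := k) (p := p) i j h)
  simpa [polY, polC] using this

/-- An algebra homomorphism out of the polynomial Clifford algebra is given by images of the
generators that satisfy the relations. -/
noncomputable def polLift {A : Type v} [Ring A] [Algebra k A] (Y C : Fin n → A)
    (h0 : ∀ i, p i = 0 → C i = 0) (h1 : ∀ i, p i = 1 → C i * C i = 1)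
    (h2 : ∀ i j, i ≠ j → C i * C j = -(C j * C i)) (h3 : ∀ i j, Y i * Y j = Y j * Y i)
    (h4 : ∀ i, Y i * C i = -(C i * Y i)) (h5 : ∀ i j, i ≠ j → Y i * C j = C j * Y i) :
    PolC k p →ₐ[k] A :=
  RingQuot.liftAlgHom k ⟨FreeAlgebra.lift k
      (fun g => match g with
        | .y i => Y i
        | .c i => C i), by
    intro a b hab
    cases hab with
    | c_even i h => simpa using h0 i h
    | c_sq i h => simpa using h1 i h
    | c_anti i j h => simpa using h2 i j h
    | y_comm i j => simpa using h3 i j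
    | y_c_same i => simpa using h4 i
    | y_c i j h => simpa using h5 i j h⟩

/-! ### Clifford Demazure operators -/

variable (k p) in
/-- The value `𝔡_i(y_j)`: it is `-1 - c_i c_{i+1}` for `j = i`, it is `1 - c_i c_{i+1}` for
`j = i + 1`, and it is `0` otherwise. -/
noncomputable def demazureY (i : Fin (n - 1)) (j : Fin n) : PolC k p :=
  if j = lo i then -1 - polC k p (lo i) * polC k p (hi i)
  else if j = hi i then 1 - polC k p (lo i) * polC k p (hi i)
  else 0

theorem lo_ne_hi (i : Fin (n - 1)) : lo i ≠ hi i := by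
  simp [lo, hi]

theorem demazureY_lo (i : Fin (n - 1)) :
    demazureY k p i (lo i) = -1 - polC k p (lo i) * polC k p (hi i) := by
  simp [demazureY]

theorem demazureY_hi (i : Fin (n - 1)) :
    demazureY k p i (hi i) = 1 - polC k p (lo i) * polC k p (hi i) := by
  simp [demazureY, (lo_ne_hi i).symm]

theorem demazureY_other {i : Fin (n - 1)} {j : Fin n} (h : j ≠ lo i) (h' : j ≠ hi i) :
    demazureY k p i j = 0 := by
  simp [demazureY, h, h']

theorem simpleSwap_lo (i : Fin (n - 1)) : simpleSwap i (lo i) = hi i := by simp [simpleSwap]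

theorem simpleSwap_hi (i : Fin (n - 1)) : simpleSwap i (hi i) = lo i := by simp [simpleSwap]

theorem simpleSwap_other {i : Fin (n - 1)} {j : Fin n} (h : j ≠ lo i) (h' : j ≠ hi i) :
    simpleSwap i j = j := by simp [simpleSwap, Equiv.swap_apply_of_ne_of_ne h h']

/-- The action of the transposition `s_i` on the polynomial Clifford algebra, which permutes the
`y`'s and the `c`'s. It exists when all indices have the same parity. -/
noncomputable def polSwap (hp : ∀ i j, p i = p j) (i : Fin (n - 1)) : PolC k p →ₐ[k] PolC k p :=
  polLift (fun j => polY k p (simpleSwap i j)) (fun j => polC k p (simpleSwap i j))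
    (fun j h => polC_even ((hp _ j).trans h))
    (fun j h => polC_sq ((hp _ j).trans h))
    (fun _ _ h => polC_anti ((simpleSwap i).injective.ne h))
    (fun _ _ => polY_comm _ _)
    (fun _ => polY_polC_same _)
    (fun _ _ h => polY_polC ((simpleSwap i).injective.ne h))

theorem demazureY_polY (i : Fin (n - 1)) (a b : Fin n) :
    polY k p (simpleSwap i a) * demazureY k p i b + demazureY k p i a * polY k p b =
      polY k p (simpleSwap i b) * demazureY k p i a + demazureY k p i b * polY k p a := by
  have hne := lo_ne_hi i
  have e1 : polY k p (lo i) * (polC k p (lo i) * polC k p (hi i)) =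
      -(polC k p (lo i) * polC k p (hi i) * polY k p (lo i)) := by
    rw [← mul_assoc, polY_polC_same, neg_mul, mul_assoc, polY_polC hne, mul_assoc]
  have e2 : polY k p (hi i) * (polC k p (lo i) * polC k p (hi i)) =
      -(polC k p (lo i) * polC k p (hi i) * polY k p (hi i)) := by
    rw [← mul_assoc, polY_polC hne.symm, mul_assoc, polY_polC_same, mul_neg, mul_assoc]
  have e3 : ∀ b, b ≠ lo i → b ≠ hi i → polY k p b * (polC k p (lo i) * polC k p (hi i)) =
      polC k p (lo i) * polC k p (hi i) * polY k p b := by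
    intro b h h'
    rw [← mul_assoc, polY_polC h, mul_assoc, polY_polC h', mul_assoc]
  by_cases ha : a = lo i
  · subst ha
    by_cases hb : b = lo i
    · subst hb; rfl
    by_cases hb' : b = hi i
    · subst hb'
      simp only [simpleSwap_lo, simpleSwap_hi, demazureY_lo, demazureY_hi, mul_sub, sub_mul, e1, e2,
        mul_one, one_mul, mul_neg, neg_mul]
      abel
    · simp only [simpleSwap_other hb hb', demazureY_lo, demazureY_other hb hb', mul_sub, sub_mul,
        e3 b hb hb', mul_one, one_mul, mul_neg, neg_mul, mul_zero, zero_mul]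
      abel
  by_cases ha' : a = hi i
  · subst ha'
    by_cases hb : b = lo i
    · subst hb
      simp only [simpleSwap_lo, simpleSwap_hi, demazureY_lo, demazureY_hi, mul_sub, sub_mul, e1, e2,
        mul_one, one_mul, mul_neg, neg_mul]
      abel
    by_cases hb' : b = hi i
    · subst hb'; rfl
    · simp only [simpleSwap_other hb hb', demazureY_hi, demazureY_other hb hb', mul_sub, sub_mul,
        e3 b hb hb', mul_one, one_mul, mul_zero, zero_mul]
      abel
  · by_cases hb : b = lo i
    · subst hb
      simp only [simpleSwap_other ha ha', demazureY_lo, demazureY_other ha ha', mul_sub, sub_mul,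
        e3 a ha ha', mul_one, one_mul, mul_neg, neg_mul, mul_zero, zero_mul]
      abel
    by_cases hb' : b = hi i
    · subst hb'
      simp only [simpleSwap_other ha ha', demazureY_hi, demazureY_other ha ha', mul_sub, sub_mul,
        e3 a ha ha', mul_one, one_mul, mul_zero, zero_mul]
      abel
    · simp [demazureY_other ha ha', demazureY_other hb hb']

theorem demazureY_polC_same (hp : ∀ i j, p i = p j) (i : Fin (n - 1)) (a : Fin n) :
    demazureY k p i a * polC k p a = -(polC k p (simpleSwap i a) * demazureY k p i a) := by
  rcases (show p a = 0 ∨ p a = 1 by generalize p a = x; revert x; decide) with h | h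
  · rw [polC_even h, polC_even ((hp _ a).trans h)]; simp
  have hl : polC k p (lo i) * polC k p (lo i) = 1 := polC_sq ((hp _ a).trans h)
  have hh : polC k p (hi i) * polC k p (hi i) = 1 := polC_sq ((hp _ a).trans h)
  have hx : polC k p (hi i) * polC k p (lo i) = -(polC k p (lo i) * polC k p (hi i)) :=
    polC_anti (lo_ne_hi i).symm
  have t1 : polC k p (lo i) * polC k p (hi i) * polC k p (lo i) = -polC k p (hi i) := by
    rw [mul_assoc, hx, mul_neg, ← mul_assoc, hl, one_mul]
  have t2 : polC k p (hi i) * (polC k p (lo i) * polC k p (hi i)) = -polC k p (lo i) := by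
    rw [← mul_assoc, hx, neg_mul, mul_assoc, hh, mul_one]
  have t3 : polC k p (lo i) * polC k p (hi i) * polC k p (hi i) = polC k p (lo i) := by
    rw [mul_assoc, hh, mul_one]
  have t4 : polC k p (lo i) * (polC k p (lo i) * polC k p (hi i)) = polC k p (hi i) := by
    rw [← mul_assoc, hl, one_mul]
  by_cases ha : a = lo i
  · subst ha
    simp only [simpleSwap_lo, demazureY_lo, sub_mul, mul_sub, neg_mul, mul_neg, one_mul, mul_one,
      t1, t2]
    abel
  by_cases ha' : a = hi i
  · subst ha'
    simp only [simpleSwap_hi, demazureY_hi, sub_mul, mul_sub, one_mul, mul_one, t3, t4]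
    abel
  · simp [demazureY_other ha ha']

theorem demazureY_polC (hp : ∀ i j, p i = p j) (i : Fin (n - 1)) {a b : Fin n} (hab : a ≠ b) :
    demazureY k p i a * polC k p b = polC k p (simpleSwap i b) * demazureY k p i a := by
  rcases (show p a = 0 ∨ p a = 1 by generalize p a = x; revert x; decide) with h | h
  · rw [polC_even ((hp b a).trans h), polC_even ((hp _ a).trans h)]; simp
  have hl : polC k p (lo i) * polC k p (lo i) = 1 := polC_sq ((hp _ a).trans h)
  have hh : polC k p (hi i) * polC k p (hi i) = 1 := polC_sq ((hp _ a).trans h)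
  have hx : polC k p (hi i) * polC k p (lo i) = -(polC k p (lo i) * polC k p (hi i)) :=
    polC_anti (lo_ne_hi i).symm
  have t1 : polC k p (lo i) * polC k p (hi i) * polC k p (lo i) = -polC k p (hi i) := by
    rw [mul_assoc, hx, mul_neg, ← mul_assoc, hl, one_mul]
  have t2 : polC k p (hi i) * (polC k p (lo i) * polC k p (hi i)) = -polC k p (lo i) := by
    rw [← mul_assoc, hx, neg_mul, mul_assoc, hh, mul_one]
  have t3 : polC k p (lo i) * polC k p (hi i) * polC k p (hi i) = polC k p (lo i) := by
    rw [mul_assoc, hh, mul_one]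
  have t4 : polC k p (lo i) * (polC k p (lo i) * polC k p (hi i)) = polC k p (hi i) := by
    rw [← mul_assoc, hl, one_mul]
  have t5 : ∀ b, b ≠ lo i → b ≠ hi i → polC k p (lo i) * polC k p (hi i) * polC k p b =
      polC k p b * (polC k p (lo i) * polC k p (hi i)) := by
    intro b h h'
    rw [mul_assoc, polC_anti h'.symm, mul_neg, ← mul_assoc, polC_anti h.symm, neg_mul, neg_neg,
      mul_assoc]
  by_cases ha : a = lo i
  · subst ha
    by_cases hb' : b = hi i
    · subst hb'
      simp only [simpleSwap_hi, demazureY_lo, sub_mul, mul_sub, neg_mul, mul_neg, one_mul, mul_one,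
        t3, t4]
      abel
    · simp only [simpleSwap_other hab.symm hb', demazureY_lo, sub_mul, mul_sub, neg_mul, mul_neg,
        one_mul, mul_one, t5 b hab.symm hb']
  by_cases ha' : a = hi i
  · subst ha'
    by_cases hb : b = lo i
    · subst hb
      simp only [simpleSwap_lo, demazureY_hi, sub_mul, mul_sub, one_mul, mul_one, t1, t2]
      abel
    · simp only [simpleSwap_other hb hab.symm, demazureY_hi, sub_mul, mul_sub,
        one_mul, mul_one, t5 b hb hab.symm]
  · simp [demazureY_other ha ha']

/-- The algebra homomorphism `f ↦ !![s_i f, 𝔡_i f; 0, f]`. That it is multiplicative says exactly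
that `𝔡_i (f g) = 𝔡_i f * g + s_i f * 𝔡_i g`. -/
noncomputable def demazureHom (hp : ∀ i j, p i = p j) (i : Fin (n - 1)) :
    PolC k p →ₐ[k] Matrix (Fin 2) (Fin 2) (PolC k p) :=
  polLift (fun j => !![polY k p (simpleSwap i j), demazureY k p i j; 0, polY k p j])
    (fun j => !![polC k p (simpleSwap i j), 0; 0, polC k p j])
    (fun j h => by
      ext a b; fin_cases a <;> fin_cases b <;> simp [polC_even h, polC_even ((hp _ j).trans h)])
    (fun j h => by
      ext a b; fin_cases a <;> fin_cases b <;>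
        simp [polC_sq h, polC_sq ((hp (simpleSwap i j) j).trans h)])
    (fun a b h => by
      have u1 := polC_anti (k := k) (p := p) ((simpleSwap i).injective.ne h)
      ext x y; fin_cases x <;> fin_cases y <;> simp [polC_anti h, u1])
    (fun a b => by
      have u1 := polY_comm (k := k) (p := p) (simpleSwap i a) (simpleSwap i b)
      have u2 := polY_comm (k := k) (p := p) a b
      have u3 := demazureY_polY (k := k) (p := p) i a b
      ext x y; fin_cases x <;> fin_cases y <;> simp [u1, u2, u3])
    (fun a => by
      have u1 := polY_polC_same (k := k) (p := p) (simpleSwap i a)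
      have u2 := polY_polC_same (k := k) (p := p) a
      have u3 := demazureY_polC_same (k := k) hp i a
      ext x y; fin_cases x <;> fin_cases y <;> simp [u1, u2, u3])
    (fun a b h => by
      have u1 := polY_polC (k := k) (p := p) ((simpleSwap i).injective.ne h)
      have u2 := polY_polC (k := k) (p := p) h
      have u3 := demazureY_polC (k := k) hp i h
      ext x y; fin_cases x <;> fin_cases y <;> simp [u1, u2, u3])

/-- The Clifford Demazure operator `𝔡_i`. -/
noncomputable def demazure (hp : ∀ i j, p i = p j) (i : Fin (n - 1)) : PolC k p →ₗ[k] PolC k p where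
  toFun f := demazureHom hp i f 0 1
  map_add' f g := by simp
  map_smul' a f := by simp

@[simp] theorem polLift_polY {A : Type v} [Ring A] [Algebra k A] (Y C : Fin n → A)
    (h0 h1 h2 h3 h4 h5) (i : Fin n) :
    polLift (k := k) (p := p) Y C h0 h1 h2 h3 h4 h5 (polY k p i) = Y i :=
  (RingQuot.liftAlgHom_mkAlgHom_apply k _ _ _).trans (by simp)

@[simp] theorem polLift_polC {A : Type v} [Ring A] [Algebra k A] (Y C : Fin n → A)
    (h0 h1 h2 h3 h4 h5) (i : Fin n) :
    polLift (k := k) (p := p) Y C h0 h1 h2 h3 h4 h5 (polC k p i) = C i :=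
  (RingQuot.liftAlgHom_mkAlgHom_apply k _ _ _).trans (by simp)

theorem polMk_surjective : Function.Surjective (polMk k p) :=
  RingQuot.mkAlgHom_surjective k (PolRel k p)

/-- Induction over the generators. -/
theorem polC_induction {P : PolC k p → Prop} (hy : ∀ i, P (polY k p i)) (hc : ∀ i, P (polC k p i))
    (hs : ∀ r : k, P (algebraMap k _ r)) (ha : ∀ f g, P f → P g → P (f + g))
    (hm : ∀ f g, P f → P g → P (f * g)) (f : PolC k p) : P f := by
  obtain ⟨x, rfl⟩ := polMk_surjective f
  induction x using FreeAlgebra.induction with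
  | grade0 r => simpa using hs r
  | grade1 g =>
    cases g with
    | y i => exact hy i
    | c i => exact hc i
  | mul a b h h' => simpa using hm _ _ h h'
  | add a b h h' => simpa using ha _ _ h h'

theorem demazureHom_apply (hp : ∀ i j, p i = p j) (i : Fin (n - 1)) (f : PolC k p) :
    demazureHom hp i f = !![polSwap hp i f, demazure hp i f; 0, f] := by
  have key : demazureHom hp i f 0 0 = polSwap hp i f ∧ demazureHom hp i f 1 0 = 0 ∧
      demazureHom hp i f 1 1 = f := by
    induction f using polC_induction with
    | hy j => simp [demazureHom, polSwap]
    | hc j => simp [demazureHom, polSwap]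
    | hs r => simp [Matrix.algebraMap_matrix_apply]
    | ha f g h h' => simp [h, h']
    | hm f g h h' => simp [Matrix.mul_apply, h, h']
  ext a b
  fin_cases a <;> fin_cases b <;> simp [key, demazure]

/-- The twisted Leibniz rule: `𝔡_i` is an `s_i`-derivation. -/
theorem demazure_mul (hp : ∀ i j, p i = p j) (i : Fin (n - 1)) (f g : PolC k p) :
    demazure hp i (f * g) = demazure hp i f * g + polSwap hp i f * demazure hp i g := by
  have h : demazure hp i (f * g) = (demazureHom hp i f * demazureHom hp i g) 0 1 := by
    simp [demazure]
  rw [h, demazureHom_apply, demazureHom_apply]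
  simp [add_comm]

@[simp] theorem demazure_polY (hp : ∀ i j, p i = p j) (i : Fin (n - 1)) (j : Fin n) :
    demazure hp i (polY k p j) = demazureY k p i j := by
  simp [demazure, demazureHom]

@[simp] theorem demazure_polC (hp : ∀ i j, p i = p j) (i : Fin (n - 1)) (j : Fin n) :
    demazure hp i (polC k p j) = 0 := by
  simp [demazure, demazureHom]

theorem demazure_algebraMap (hp : ∀ i j, p i = p j) (i : Fin (n - 1)) (r : k) :
    demazure hp i (algebraMap k (PolC k p) r) = 0 := by
  simp [demazure, Matrix.algebraMap_matrix_apply]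

variable (k) in
/-- The algebra of `𝔡`-symmetric polynomials: the common kernel of the Clifford Demazure
operators. -/
noncomputable def SymPolC (hp : ∀ i j, p i = p j) : Subalgebra k (PolC k p) where
  carrier := {f | ∀ i, demazure hp i f = 0}
  mul_mem' {f g} hf hg i := by rw [demazure_mul, hf i, hg i]; simp
  add_mem' {f g} hf hg i := by rw [map_add, hf i, hg i, add_zero]
  algebraMap_mem' r i := demazure_algebraMap hp i r

/-! ### Elementary and complete symmetric polynomials -/

variable (k p) in
/-- The elementary polynomials `𝔢^{(j)}_m`, with `𝔢^{(j)}_0 = 1`, `𝔢^{(j)}_m = 0` for `m > j`, and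
`𝔢^{(j)}_m = 𝔢^{(j-1)}_m + 𝔢^{(j-1)}_{m-1} κ_{m,j} y_j` for `1 ≤ m ≤ j ≤ n`. -/
noncomputable def elemSym : ℕ → ℕ → PolC k p
  | _, 0 => 1
  | 0, _ + 1 => 0
  | j + 1, m + 1 => elemSym j (m + 1) +
      if h : m ≤ j ∧ j < n then
        elemSym j m * kappa p (polC k p) ⟨m, by omega⟩ ⟨j, h.2⟩ * polY k p ⟨j, h.2⟩
      else 0

variable (k p) in
/-- The matrix with first column `(𝔢_1, -𝔢_2, …, (-1)^{n-1} 𝔢_n)`, superdiagonal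
`(κ̃_{1,2}, …, κ̃_{1,n})`, and all other entries zero. -/
noncomputable def symMatrix [NeZero n] : Matrix (Fin n) (Fin n) (PolC k p) :=
  Matrix.of fun i j =>
    if j = 0 then (-1) ^ i.1 * elemSym k p n (i.1 + 1)
    else if j.1 = i.1 + 1 then kappaTilde p (polC k p) 0 j
    else 0

variable (k p) in
/-- The complete symmetric polynomial `h^{(n)}_r`. -/
noncomputable def completeSym [NeZero n] (r : ℕ) : PolC k p := (symMatrix k p ^ r) 0 0

variable (k) in
/-- The relations `h^{(n)}_r = 0` for `r > m - n`. -/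
def GrassmannRel [NeZero n] (hp : ∀ i j, p i = p j) (m : ℕ) (a b : SymPolC k hp) : Prop :=
  (∃ r : ℕ, (m : ℤ) - (n : ℤ) < (r : ℤ) ∧ (a : PolC k p) = completeSym k p r) ∧ b = 0

variable (k) in
/-- The Clifford Grassmannian cohomology ring: the quotient of the algebra of `𝔡`-symmetric
polynomials by the two-sided ideal generated by all `h^{(n)}_r` with `r > m - n`. -/
def GrassmannC [NeZero n] (hp : ∀ i j, p i = p j) (m : ℕ) : Type u :=
  RingQuot (GrassmannRel k hp m)

noncomputable instance [NeZero n] (hp : ∀ i j, p i = p j) (m : ℕ) : Ring (GrassmannC k hp m) :=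
  inferInstanceAs (Ring (RingQuot (GrassmannRel k hp m)))

noncomputable instance [NeZero n] (hp : ∀ i j, p i = p j) (m : ℕ) :
    Algebra k (GrassmannC k hp m) :=
  inferInstanceAs (Algebra k (RingQuot (GrassmannRel k hp m)))

end Pol

/-! ### The NilHecke Clifford algebra -/

/-- Generators of the NilHecke Clifford algebra. -/
inductive NilHeckeGen (n : ℕ) : Type
  | y (i : Fin n)
  | c (i : Fin n)
  | d (i : Fin (n - 1))

section NilHecke

variable (k : Type u) [Field k] {n : ℕ} (p : Fin n → ZMod 2)

/-- Defining relations of the NilHecke Clifford algebra. The Clifford generators of even indices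
are set to `0`; the others square to `1`. -/
inductive NilHeckeRel : FreeAlgebra k (NilHeckeGen n) → FreeAlgebra k (NilHeckeGen n) → Prop
  | c_even (i : Fin n) : p i = 0 → NilHeckeRel (FreeAlgebra.ι k (.c i)) 0
  | c_sq (i : Fin n) : p i = 1 →
      NilHeckeRel (FreeAlgebra.ι k (.c i) * FreeAlgebra.ι k (.c i)) 1
  | c_anti (i j : Fin n) : i ≠ j →
      NilHeckeRel (FreeAlgebra.ι k (.c i) * FreeAlgebra.ι k (.c j))
        (-(FreeAlgebra.ι k (.c j) * FreeAlgebra.ι k (.c i)))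
  | y_comm (i j : Fin n) :
      NilHeckeRel (FreeAlgebra.ι k (.y i) * FreeAlgebra.ι k (.y j))
        (FreeAlgebra.ι k (.y j) * FreeAlgebra.ι k (.y i))
  | y_c_same (i : Fin n) :
      NilHeckeRel (FreeAlgebra.ι k (.y i) * FreeAlgebra.ι k (.c i))
        (-(FreeAlgebra.ι k (.c i) * FreeAlgebra.ι k (.y i)))
  | y_c (i j : Fin n) : i ≠ j →
      NilHeckeRel (FreeAlgebra.ι k (.y i) * FreeAlgebra.ι k (.c j))
        (FreeAlgebra.ι k (.c j) * FreeAlgebra.ι k (.y i))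
  | d_y_lo (i : Fin (n - 1)) :
      NilHeckeRel
        (FreeAlgebra.ι k (.d i) * FreeAlgebra.ι k (.y (lo i))
          - FreeAlgebra.ι k (.y (hi i)) * FreeAlgebra.ι k (.d i))
        (-1 - FreeAlgebra.ι k (.c (lo i)) * FreeAlgebra.ι k (.c (hi i)))
  | d_y_hi (i : Fin (n - 1)) :
      NilHeckeRel
        (FreeAlgebra.ι k (.d i) * FreeAlgebra.ι k (.y (hi i))
          - FreeAlgebra.ι k (.y (lo i)) * FreeAlgebra.ι k (.d i))
        (1 - FreeAlgebra.ι k (.c (lo i)) * FreeAlgebra.ι k (.c (hi i)))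
  | d_y (i : Fin (n - 1)) (j : Fin n) : j ≠ lo i → j ≠ hi i →
      NilHeckeRel
        (FreeAlgebra.ι k (.d i) * FreeAlgebra.ι k (.y j)
          - FreeAlgebra.ι k (.y j) * FreeAlgebra.ι k (.d i)) 0
  | d_c (i : Fin (n - 1)) (j : Fin n) :
      NilHeckeRel (FreeAlgebra.ι k (.d i) * FreeAlgebra.ι k (.c j))
        (FreeAlgebra.ι k (.c (simpleSwap i j)) * FreeAlgebra.ι k (.d i))
  | d_sq (i : Fin (n - 1)) :
      NilHeckeRel (FreeAlgebra.ι k (.d i) * FreeAlgebra.ι k (.d i)) 0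
  | d_comm (i j : Fin (n - 1)) : i.1 + 1 < j.1 ∨ j.1 + 1 < i.1 →
      NilHeckeRel (FreeAlgebra.ι k (.d i) * FreeAlgebra.ι k (.d j))
        (FreeAlgebra.ι k (.d j) * FreeAlgebra.ι k (.d i))
  | d_braid (i j : Fin (n - 1)) : j.1 = i.1 + 1 →
      NilHeckeRel
        (FreeAlgebra.ι k (.d i) * FreeAlgebra.ι k (.d j) * FreeAlgebra.ι k (.d i))
        (FreeAlgebra.ι k (.d j) * FreeAlgebra.ι k (.d i) * FreeAlgebra.ι k (.d j))

/-- The NilHecke Clifford algebra. -/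
def NilHeckeC : Type u := RingQuot (NilHeckeRel k p)

noncomputable instance : Ring (NilHeckeC k p) := inferInstanceAs (Ring (RingQuot (NilHeckeRel k p)))

noncomputable instance : Algebra k (NilHeckeC k p) :=
  inferInstanceAs (Algebra k (RingQuot (NilHeckeRel k p)))

/-- The projection from the free algebra. -/
noncomputable def nilMk : FreeAlgebra k (NilHeckeGen n) →ₐ[k] NilHeckeC k p :=
  RingQuot.mkAlgHom k (NilHeckeRel k p)

/-- The generator `y_i` of the NilHecke Clifford algebra. -/
noncomputable def nilY (i : Fin n) : NilHeckeC k p := nilMk k p (FreeAlgebra.ι k (.y i))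

/-- The generator `c_i` of the NilHecke Clifford algebra. -/
noncomputable def nilC (i : Fin n) : NilHeckeC k p := nilMk k p (FreeAlgebra.ι k (.c i))

/-- The relation `(κ_{1,n} y_n)^m = 0`. -/
def CyclotomicRel [NeZero n] (m : ℕ) (a b : NilHeckeC k p) : Prop :=
  a = (kappa p (nilC k p) 0 (lastIdx n) * nilY k p (lastIdx n)) ^ m ∧ b = 0

/-- The `m`-th cyclotomic quotient: the quotient of the NilHecke Clifford algebra by the two-sided
ideal generated by `(κ_{1,n} y_n)^m`. -/
def CyclotomicC [NeZero n] (m : ℕ) : Type u := RingQuot (CyclotomicRel k p m)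

noncomputable instance [NeZero n] (m : ℕ) : Ring (CyclotomicC k p m) :=
  inferInstanceAs (Ring (RingQuot (CyclotomicRel k p m)))

noncomputable instance [NeZero n] (m : ℕ) : Algebra k (CyclotomicC k p m) :=
  inferInstanceAs (Algebra k (RingQuot (CyclotomicRel k p m)))

end NilHecke

end CliffordNilHecke

/-! Write ε = -1 for odd indices and ε = 1 for even ones, and number indices from 0. The variables
z_i = κ_{0,i} y_i, which are ±c_i y_i in the odd case, commute up to the factor ε with one another
and with the Clifford generators. Put u_i = 𝔡_i(z_{i+1}). It is 1 in the even case and ±(c_i -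
c_{i+1}) in the odd case, where its square is 2; since 2 ≠ 0 there, u_i is invertible. The operators
δ_i = u_i⁻¹ 𝔡_i then satisfy the nil Hecke (ε = 1) or odd nil Hecke (ε = -1) relations, so both
parities are treated at once (`skewNilHecke_nilHeckeC`).

These relations alone give dual bases (`exists_dual_basis`). An element killed by the δ's among z_0,
…, z_{t-1} is uniquely a sum of z_t^d x_d, d ≤ t, with x_d killed by δ_{t-1} as well, and descending
products of δ's extract the x_d. Iteration gives n! pairs b_w, θ_w with 𝔡_i θ_w = 0, ∑ b_w θ_w = 1
and θ_v b_w acting on symmetric polynomials as the Kronecker delta. As r f θ_w depends only on the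
polynomial r·f (`mul_polToNil_mul`), every r is the sum of the b_v s_{vw} θ_w with s_{vw} = (θ_v r
b_w)·1 symmetric. Hence the NilHecke Clifford algebra is the matrix algebra over the symmetric
polynomials; neither a normal form nor faithfulness of the polynomial representation is needed
beforehand.

For the cyclotomic quotient, δ_0 ⋯ δ_{n-2} sends z_{n-1}^{r+n-1} to the complete polynomial of
degree r (`complete_eq_polRep`). So the ideal of z_{n-1}^m contains the scalar matrices of all
complete polynomials of degree > m - n. Conversely, z_{n-1}^m is a complete polynomial in one
variable, and dropping variables one at a time puts it in the left ideal generated by those complete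
polynomials (`complete_mem_coordKer`). This gives homomorphisms in both directions and the
isomorphism (`cyclotomicToMatrix_bijective`).

Finally, the matrix entry h_r is a complete polynomial whose monomials have decreasing indices
(`completeSym_eq`), whereas the δ's produce increasing ones. In the odd case the order matters, so
the automorphism reversing the indices, which preserves symmetric polynomials, is inserted before
passing to the Grassmannian ring. -/

namespace CliffordNilHecke

/-! ### Nil Hecke relations up to a sign -/

/-- The relations between polynomial generators `z` and divided difference operators `δ` of the nil
Hecke algebra (`ε = 1`) and of the odd nil Hecke algebra (`ε = -1`). -/
structure SkewNilHecke {A : Type*} [Ring A] (ε : ℤ) (n : ℕ) (z δ : ℕ → A) : Prop where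
  sign : ε * ε = 1
  d_z : ∀ i j, j ≠ i → j ≠ i + 1 → δ i * z j = ε • (z j * δ i)
  d_z_succ : ∀ i, i + 1 < n → δ i * z (i + 1) = z i * δ i + 1
  d_sq : ∀ i, δ i * δ i = 0
  d_comm : ∀ i j, i + 1 < j → δ i * δ j = ε • (δ j * δ i)
  d_braid : ∀ i, δ i * δ (i + 1) * δ i = ε • (δ (i + 1) * δ i * δ (i + 1))

/-- `x` is annihilated by the operators among the first `t` indices. -/
def Killed {A M : Type*} [Ring A] [AddCommGroup M] [Module A M] (δ : ℕ → A) (t : ℕ) (x : M) :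
    Prop :=
  ∀ i, i + 1 < t → δ i • x = 0

/-- The product `δ (t - d) * ⋯ * δ (t - 1)`. -/
def descent {A : Type*} [Ring A] (δ : ℕ → A) (t : ℕ) : ℕ → A
  | 0 => 1
  | d + 1 => δ (t - (d + 1)) * descent δ t d

/-- The complete symmetric polynomial of degree `r` in `z (t - d), …, z t`, with the indices of each
monomial increasing. -/
def complete {A : Type*} [Ring A] (z : ℕ → A) (t : ℕ) : ℕ → ℕ → A
  | 0, r => z t ^ r
  | _ + 1, 0 => 1
  | d + 1, r + 1 => z (t - (d + 1)) * complete z t (d + 1) r + complete z t d (r + 1)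

/-- The operator that strips off the components at `z t ^ t, …, z t ^ (t - s + 1)`. -/
def strip {A : Type*} [Ring A] (z δ : ℕ → A) (t : ℕ) : ℕ → A
  | 0 => 1
  | s + 1 => (1 - z t ^ (t - s) * descent δ t (t - s)) * strip z δ t s

/-- The coordinate function at `z t ^ d`. -/
def coord {A : Type*} [Ring A] (z δ : ℕ → A) (t d : ℕ) : A :=
  descent δ t d * strip z δ t (t - d)

@[simp] theorem complete_zero {A : Type*} [Ring A] (z : ℕ → A) (t d : ℕ) :
    complete z t d 0 = 1 := by
  cases d <;> simp [complete]

theorem complete_succ_succ {A : Type*} [Ring A] (z : ℕ → A) (t d r : ℕ) :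
    complete z t (d + 1) (r + 1) =
      z (t - (d + 1)) * complete z t (d + 1) r + complete z t d (r + 1) := by
  rw [complete]

/-! ### Dual bases, one variable at a time -/

namespace SkewNilHecke

variable {A M : Type*} [Ring A] [AddCommGroup M] [Module A M] {ε : ℤ} {n : ℕ} {z δ : ℕ → A}
  (h : SkewNilHecke ε n z δ)

include h

theorem d_comm_of_far {i j : ℕ} (hij : i + 1 < j ∨ j + 1 < i) : δ i * δ j = ε • (δ j * δ i) := by
  rcases hij with hij | hij
  · exact h.d_comm i j hij
  · rw [h.d_comm j i hij, smul_smul, h.sign, one_smul]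

theorem d_pow {i j : ℕ} (h1 : j ≠ i) (h2 : j ≠ i + 1) (r : ℕ) :
    δ i * z j ^ r = ε ^ r • (z j ^ r * δ i) := by
  induction r with
  | zero => simp
  | succ r ih =>
    rw [pow_succ, ← mul_assoc, ih, smul_mul_assoc, mul_assoc, h.d_z i j h1 h2, mul_smul_comm,
      smul_smul, ← pow_succ, mul_assoc]

theorem d_complete {i t d : ℕ} (hi : i + 1 + d < t) (r : ℕ) :
    δ i * complete z t d r = ε ^ r • (complete z t d r * δ i) := by
  induction d generalizing r with
  | zero => simpa [complete] using h.d_pow (j := t) (by omega) (by omega) r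
  | succ d ihd =>
    induction r with
    | zero => simp
    | succ r ih =>
      rw [complete, mul_add, ← mul_assoc, h.d_z i (t - (d + 1)) (by omega) (by omega), smul_mul_assoc,
        mul_assoc, ih, mul_smul_comm, smul_smul, ← pow_succ', ihd (by omega), ← smul_add, add_mul,
        mul_assoc]

/-- Only the lowest variable z_{t-d} meets δ_{t-(d+1)} nontrivially; the later ones commute with it
up to ε until it reaches x. Splitting off z_{t-d} on the left therefore reproduces the recursion for
one more variable. -/
theorem d_smul_complete {t d : ℕ} (hd : d < t) (ht : t < n) {x : M}
    (hx : δ (t - (d + 1)) • x = 0) (r : ℕ) :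
    δ (t - (d + 1)) • complete z t d (r + 1) • x = complete z t (d + 1) r • x := by
  have key : ∀ y : M, δ (t - (d + 1)) • z (t - d) • y =
      z (t - (d + 1)) • δ (t - (d + 1)) • y + y := by
    intro y
    have e := h.d_z_succ (t - (d + 1)) (by omega)
    rw [show t - (d + 1) + 1 = t - d by omega] at e
    rw [smul_smul, e, add_smul, mul_smul, one_smul]
  induction r with
  | zero =>
    cases d with
    | zero => simpa [complete, hx] using key x
    | succ d =>
      rw [complete_zero, one_smul, complete_succ_succ, complete_zero, mul_one, add_smul, smul_add,
        key, hx, smul_zero, zero_add, smul_smul (δ _), h.d_complete (by omega), smul_assoc,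
        mul_smul, hx, smul_zero, smul_zero, add_zero]
  | succ r ih =>
    cases d with
    | zero =>
      rw [complete, pow_succ', mul_smul]
      have := key (z t ^ (r + 1) • x)
      rw [Nat.sub_zero] at this
      rw [this]
      simp only [complete] at ih ⊢
      rw [ih, add_smul, mul_smul]
    | succ d =>
      rw [complete_succ_succ z t d, complete_succ_succ z t (d + 1), add_smul, mul_smul, smul_add,
        key, ih, smul_smul (δ _) (complete z t d _), h.d_complete (by omega), smul_assoc,
        mul_smul (complete z t d _), hx, smul_zero, smul_zero, add_zero, add_smul, mul_smul]

/-- The power z_t^r is the complete polynomial in one variable, and each further δ adds a variable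
and lowers the degree by one. Once the degree is 0, the next δ acts directly on x. -/
theorem descent_smul_pow {t d : ℕ} (hd : d ≤ t) (ht : t < n) {x : M} (hx : Killed δ (t + 1) x)
    (r : ℕ) :
    descent δ t d • z t ^ r • x = if r < d then 0 else complete z t d (r - d) • x := by
  induction d with
  | zero => simp [descent, complete]
  | succ d ih =>
    rw [descent, mul_smul, ih (by omega)]
    rcases lt_trichotomy r d with hr | rfl | hr
    · rw [if_pos hr, if_pos (by omega), smul_zero]
    · simp [hx (t - (r + 1)) (by omega)]
    · obtain ⟨r, rfl⟩ := Nat.exists_eq_add_of_lt hr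
      rw [if_neg (by omega), if_neg (by omega), show d + r + 1 - d = r + 1 by omega,
        h.d_smul_complete (by omega) ht (hx _ (by omega)), show d + r + 1 - (d + 1) = r by omega]

theorem d_descent {t d i : ℕ} (hi : i + 1 + d < t) :
    δ i * descent δ t d = ε ^ d • (descent δ t d * δ i) := by
  induction d with
  | zero => simp [descent]
  | succ d ih =>
    rw [descent, ← mul_assoc, h.d_comm _ _ (by omega), smul_mul_assoc, mul_assoc, ih (by omega),
      mul_smul_comm, smul_smul, ← pow_succ', mul_assoc]

theorem d_descent_smul_of_lt {t d i : ℕ} (hi : i + 1 + d < t) {x : M} (hx : Killed δ t x) :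
    δ i • descent δ t d • x = 0 := by
  rw [smul_smul, h.d_descent hi, smul_assoc, mul_smul, hx i (by omega), smul_zero, smul_zero]

/-- If i is the first index of the product, δ_i² = 0. If it is the second, the braid relation leaves
δ_{i-1} on the right, which passes the remaining factors and kills x. Otherwise δ_i passes the first
factor. -/
theorem d_descent_smul_of_le {t d i : ℕ} (hd : d ≤ t) (hi : t ≤ i + d) (hit : i < t) {x : M}
    (hx : Killed δ t x) : δ i • descent δ t d • x = 0 := by
  induction d with
  | zero => omega
  | succ d ih =>
    rw [descent, mul_smul]
    rcases (show i = t - (d + 1) ∨ i = t - d ∨ t - (d + 1) + 1 < i by omega) with rfl | h1 | h1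
    · rw [smul_smul, h.d_sq, zero_smul]
    · obtain ⟨d, rfl⟩ : ∃ e, d = e + 1 := ⟨d - 1, by omega⟩
      have hb := h.d_braid (t - (d + 1 + 1))
      rw [show t - (d + 1 + 1) + 1 = i by omega] at hb
      have hb' : δ i * δ (t - (d + 1 + 1)) * δ i = ε • (δ (t - (d + 1 + 1)) * δ i *
          δ (t - (d + 1 + 1))) := by
        rw [hb, smul_smul, h.sign, one_smul]
      rw [descent, ← h1, mul_smul, smul_smul, smul_smul, hb', smul_assoc, mul_smul,
        h.d_descent_smul_of_lt (by omega) hx, smul_zero, smul_zero]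
    · rw [smul_smul, h.d_comm_of_far (Or.inr h1), smul_assoc, mul_smul, ih (by omega) (by omega),
        smul_zero, smul_zero]

theorem killed_pow {t : ℕ} {x : M} (hx : Killed δ t x) (r : ℕ) : Killed δ t (z t ^ r • x) := by
  intro i hi
  rw [smul_smul, h.d_pow (by omega) (by omega), smul_assoc, mul_smul, hx i hi, smul_zero, smul_zero]

/-- The only δ_i not handled by the two preceding lemmas is the one that lengthens the product by a
factor; `hx'` takes care of it. For d = t no such factor exists, and `hx'` is void. -/
theorem killed_descent {t d : ℕ} (hd : d ≤ t) {x : M} (hx : Killed δ t x)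
    (hx' : d + 1 ≤ t → descent δ t (d + 1) • x = 0) : Killed δ (t + 1) (descent δ t d • x) := by
  intro i hi
  rcases (show i + 1 + d < t ∨ t = i + 1 + d ∨ t ≤ i + d by omega) with h1 | h1 | h1
  · exact h.d_descent_smul_of_lt h1 hx
  · have := hx' (by omega)
    rwa [descent, mul_smul, show t - (d + 1) = i by omega] at this
  · exact h.d_descent_smul_of_le hd h1 (by omega) hx

/-- After s steps the top s components are gone, so the product of length t + 1 - s vanishes on the
rest. This makes the next component fully killed, and subtracting it preserves the pattern. At s = 0
the product would have t + 1 factors, one too many, hence the guard. -/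
theorem killed_strip {t s : ℕ} (hs : s ≤ t + 1) (ht : t < n) {x : M} (hx : Killed δ t x) :
    Killed δ t (strip z δ t s • x) ∧
      (1 ≤ s → descent δ t (t + 1 - s) • strip z δ t s • x = 0) := by
  induction s with
  | zero => simpa [strip] using hx
  | succ s ih =>
    obtain ⟨h1, h2⟩ := ih (by omega)
    have h3 : Killed δ (t + 1) (descent δ t (t - s) • strip z δ t s • x) := by
      refine h.killed_descent (by omega) h1 fun hs => ?_
      rw [show t - s + 1 = t + 1 - s by omega]
      exact h2 (by omega)
    have e : strip z δ t (s + 1) • x = strip z δ t s • x -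
        z t ^ (t - s) • descent δ t (t - s) • strip z δ t s • x := by
      rw [strip, sub_mul, one_mul, sub_smul, mul_smul, mul_smul]
    constructor
    · intro i hi
      rw [e, smul_sub, h1 i hi, h.killed_pow (fun j hj => h3 j (by omega)) _ i hi, sub_zero]
    · intro _
      rw [e, smul_sub, show t + 1 - (s + 1) = t - s by omega,
        h.descent_smul_pow (by omega) ht h3, if_neg (lt_irrefl _), Nat.sub_self, complete_zero,
        one_smul, sub_self]

theorem killed_coord {t d : ℕ} (hd : d ≤ t) (ht : t < n) {x : M} (hx : Killed δ t x) :
    Killed δ (t + 1) (coord z δ t d • x) := by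
  obtain ⟨h1, h2⟩ := h.killed_strip (s := t - d) (by omega) ht hx
  rw [coord, mul_smul]
  refine h.killed_descent hd h1 fun hd' => ?_
  rw [show d + 1 = t + 1 - (t - d) by omega]
  exact h2 (by omega)

theorem sum_pow_coord {t : ℕ} (ht : t < n) {x : M} (hx : Killed δ t x) :
    ∑ d ∈ Finset.range (t + 1), z t ^ d • coord z δ t d • x = x := by
  have key : ∀ s, s ≤ t + 1 → strip z δ t s • x +
      ∑ i ∈ Finset.range s, z t ^ (t - i) • coord z δ t (t - i) • x = x := by
    intro s hs
    induction s with
    | zero => simp [strip]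
    | succ s ih =>
      rw [Finset.sum_range_succ, strip, coord, show t - (t - s) = s by omega, sub_mul, one_mul,
        sub_smul]
      convert ih (by omega) using 1
      simp only [mul_smul]
      abel
  -- For s = t + 1 the descending product is empty, so the vanishing says that nothing remains after
  -- stripping.
  have h0 := (h.killed_strip (s := t + 1) le_rfl ht hx).2 (by omega)
  rw [Nat.sub_self, descent, one_smul] at h0
  have := key (t + 1) le_rfl
  rw [h0, zero_add] at this
  rw [← Finset.sum_range_reflect]
  simpa using this

/-- The factor for exponent t - s annihilates exactly that power: the descending product kills lower
powers, and higher ones are already gone. -/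
theorem strip_smul_pow {t s b : ℕ} (hs : s ≤ t + 1) (hb : b ≤ t) (ht : t < n) {x : M}
    (hx : Killed δ (t + 1) x) :
    strip z δ t s • z t ^ b • x = if s + b ≤ t then z t ^ b • x else 0 := by
  induction s with
  | zero => simp [strip, hb]
  | succ s ih =>
    rw [strip, mul_smul, ih (by omega), sub_smul, one_smul, mul_smul]
    rcases lt_trichotomy (s + b) t with h1 | h1 | h1
    · rw [if_pos h1.le, if_pos (by omega), h.descent_smul_pow (by omega) ht hx,
        if_pos (by omega), smul_zero, sub_zero]
    · rw [if_pos h1.le, if_neg (by omega), h.descent_smul_pow (by omega) ht hx,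
        if_neg (by omega), show t - s = b by omega, Nat.sub_self, complete_zero, one_smul, sub_self]
    · rw [if_neg (by omega), if_neg (by omega), smul_zero, smul_zero, sub_zero]

theorem coord_smul_pow {t d b : ℕ} (hd : d ≤ t) (hb : b ≤ t) (ht : t < n) {x : M}
    (hx : Killed δ (t + 1) x) :
    coord z δ t d • z t ^ b • x = if d = b then x else 0 := by
  rw [coord, mul_smul, h.strip_smul_pow (by omega) hb ht hx]
  rcases lt_trichotomy d b with h1 | rfl | h1
  · rw [if_neg (by omega), if_neg (by omega), smul_zero]
  · rw [if_pos (by omega), if_pos rfl, h.descent_smul_pow hd ht hx, if_neg (lt_irrefl _),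
      Nat.sub_self, complete_zero, one_smul]
  · rw [if_pos (by omega), if_neg (by omega), h.descent_smul_pow hd ht hx, if_pos h1]

/-- Dual bases of polynomials over the symmetric ones. -/
theorem exists_dual_basis (M : Type*) [AddCommGroup M] [Module A M] {t : ℕ} (ht : t ≤ n) :
    ∃ b θ : Fin t.factorial → A, (∀ w, Killed δ t (θ w)) ∧ ∑ w, b w * θ w = 1 ∧
      ∀ x : M, Killed δ t x → ∀ v w, θ v • b w • x = if v = w then x else 0 := by
  induction t with
  | zero =>
    refine ⟨fun _ => 1, fun _ => 1, fun w i hi => by omega, ?_, fun x _ v w => ?_⟩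
    · exact (Fin.sum_univ_one (fun _ => (1 : A) * 1)).trans (one_mul 1)
    · obtain rfl : v = w := Subsingleton.elim (α := Fin 1) v w
      change (1 : A) • (1 : A) • x = _
      rw [one_smul, one_smul]
      exact (if_pos rfl).symm
  | succ t ih =>
    obtain ⟨b, θ, h1, h2, h3⟩ := ih (by omega)
    -- The new basis consists of the products b_w z_t^d, with d ≤ t; the count uses that (t + 1)!
    -- unfolds to (t + 1) · t!.
    let e : Fin (t + 1) × Fin t.factorial ≃ Fin (t + 1).factorial := finProdFinEquiv
    refine ⟨fun w => b (e.symm w).2 * z t ^ ((e.symm w).1 : ℕ),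
      fun w => coord z δ t (e.symm w).1 * θ (e.symm w).2, fun w => ?_, ?_, fun x hx v w => ?_⟩
    · exact h.killed_coord (by omega) (by omega) (h1 _)
    · rw [e.symm.sum_comp (fun w : Fin (t + 1) × Fin t.factorial =>
        b w.2 * z t ^ (w.1 : ℕ) * (coord z δ t w.1 * θ w.2)), Fintype.sum_prod_type_right, ← h2]
      refine Finset.sum_congr rfl fun w _ => ?_
      have := h.sum_pow_coord (by omega) (h1 w)
      simp only [smul_eq_mul] at this
      conv_rhs => rw [← this]
      rw [Finset.mul_sum, Finset.sum_range]
      simp only [mul_assoc]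
    -- The power of z_t is still killed by the δ's below it, so the inner pair collapses first and
    -- the coordinate function at z_t then acts.
    · have h4 : Killed δ t (z t ^ ((e.symm w).1 : ℕ) • x) :=
        h.killed_pow (fun i hi => hx i (by omega)) _
      rw [mul_smul, mul_smul, h3 _ h4]
      have : v = w ↔ (e.symm v).2 = (e.symm w).2 ∧ ((e.symm v).1 : ℕ) = ((e.symm w).1 : ℕ) := by
        rw [← e.symm.injective.eq_iff, Prod.ext_iff, and_comm, Fin.ext_iff (n := t + 1)]
      simp only [this]
      by_cases h5 : (e.symm v).2 = (e.symm w).2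
      · rw [if_pos h5, h.coord_smul_pow (by omega) (by omega) (by omega) hx]
        simp [h5]
      · rw [if_neg h5, if_neg (by tauto), smul_zero]

end SkewNilHecke

/-! ### Signed variables and their divided differences -/

section SignedVariables

variable {k : Type*} [Field k] {n : ℕ}

open Classical in
/-- The sign `-1` if there are odd indices and `1` otherwise. -/
noncomputable def paritySign (p : Fin n → ZMod 2) : ℤ := if ∃ i, p i = 1 then -1 else 1

theorem paritySign_sq (p : Fin n → ZMod 2) : paritySign p * paritySign p = 1 := by
  unfold paritySign; split_ifs <;> simp

theorem parity_cases {p : Fin n → ZMod 2} (hp : ∀ i j, p i = p j) :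
    ((∃ i, p i = 1) ∧ paritySign p = -1 ∧ ∀ i, p i = 1) ∨
      ((¬ ∃ i, p i = 1) ∧ paritySign p = 1 ∧ ∀ i, p i = 0) := by
  by_cases h : ∃ i, p i = 1
  · refine Or.inl ⟨h, by simp [paritySign, h], fun i => ?_⟩
    obtain ⟨j, hj⟩ := h
    exact (hp i j).trans hj
  · refine Or.inr ⟨h, by simp [paritySign, h], fun i => ?_⟩
    have : ∀ a : ZMod 2, a ≠ 1 → a = 0 := by decide
    exact this _ fun hi => h ⟨i, hi⟩

open Classical in
/-- `c_i` for odd indices and `1` for even ones, in any ring. -/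
noncomputable def cliffordFactor {A : Type*} [Ring A] (p : Fin n → ZMod 2) (c : Fin n → A)
    (i : Fin n) : A :=
  if ∃ i, p i = 1 then c i else 1

variable (k) (p : Fin n → ZMod 2)

/-- `c_i y_i` for odd indices and `y_i` for even ones. -/
noncomputable def polX (i : Fin n) : PolC k p := cliffordFactor p (polC k p) i * polY k p i

/-- The signed variable `κ_{1,i} y_i`. -/
noncomputable def polZ (i : ℕ) : PolC k p :=
  if h : i < n then paritySign p ^ i • polX k p ⟨i, h⟩ else 0

open Classical in
/-- The value of the Demazure operator at the signed variable of index `i + 1`. -/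
noncomputable def polU (i : Fin (n - 1)) : PolC k p :=
  if ∃ i, p i = 1 then (-1 : ℤ) ^ (i.1 + 1) • (polC k p (lo i) - polC k p (hi i)) else 1

open Classical in
/-- The inverse of `polU`. -/
noncomputable def polV (i : Fin (n - 1)) : PolC k p :=
  if ∃ i, p i = 1 then (2⁻¹ : k) • polU k p i else 1

variable {k p}

@[simp] theorem polSwap_polY (hp : ∀ i j, p i = p j) (i : Fin (n - 1)) (j : Fin n) :
    polSwap hp i (polY k p j) = polY k p (simpleSwap i j) := by simp [polSwap]

@[simp] theorem polSwap_polC (hp : ∀ i j, p i = p j) (i : Fin (n - 1)) (j : Fin n) :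
    polSwap hp i (polC k p j) = polC k p (simpleSwap i j) := by simp [polSwap]

variable (hp : ∀ i j, p i = p j)

include hp in
-- In the odd case exactly one of the two factors of c_i y_i anticommutes with c_j: y_i if i = j,
-- and c_i otherwise. So the sign does not depend on i and j.
theorem polX_polC (i j : Fin n) :
    polX k p i * polC k p j = paritySign p • (polC k p j * polX k p i) := by
  rcases parity_cases hp with ⟨h, e, h1⟩ | ⟨h, e, h1⟩
  · simp only [polX, cliffordFactor, if_pos h, e]
    by_cases hij : i = j
    · subst hij
      rw [mul_assoc, polY_polC_same]
      simp
    · rw [mul_assoc, polY_polC hij, ← mul_assoc, polC_anti hij]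
      simp [mul_assoc]
  · simp [polC_even (h1 _)]

include hp in
theorem polX_comm {i j : Fin n} (hij : i ≠ j) :
    polX k p i * polX k p j = paritySign p • (polX k p j * polX k p i) := by
  rcases parity_cases hp with ⟨h, e, h1⟩ | ⟨h, e, h1⟩
  · have h2 := polX_polC (k := k) hp i j
    have h3 : polX k p i * polY k p j = polY k p j * polX k p i := by
      simp only [polX, cliffordFactor, if_pos h]
      rw [mul_assoc, polY_comm, ← mul_assoc, ← polY_polC hij.symm, mul_assoc]
    nth_rewrite 2 [polX]
    nth_rewrite 2 [polX]
    simp only [cliffordFactor, if_pos h]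
    rw [← mul_assoc, h2, smul_mul_assoc, mul_assoc, h3, mul_assoc]
  · simp [polX, cliffordFactor, h, e, polY_comm i j]

theorem polSwap_polX (i : Fin (n - 1)) (j : Fin n) :
    polSwap hp i (polX k p j) = polX k p (simpleSwap i j) := by
  unfold polX cliffordFactor; split_ifs <;> simp

include hp in
theorem polZ_polC (i : ℕ) (j : Fin n) :
    polZ k p i * polC k p j = paritySign p • (polC k p j * polZ k p i) := by
  unfold polZ
  split_ifs
  · rw [smul_mul_assoc, polX_polC hp, mul_smul_comm, smul_comm]
  · simp

include hp in
theorem polZ_comm {i j : ℕ} (hij : i ≠ j) :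
    polZ k p i * polZ k p j = paritySign p • (polZ k p j * polZ k p i) := by
  by_cases hi : i < n <;> by_cases hj : j < n <;> simp only [polZ, hi, hj, dif_pos, dif_neg,
    not_false_eq_true, mul_zero, zero_mul, smul_zero]
  rw [smul_mul_smul_comm, polX_comm hp (by simpa using hij), smul_mul_smul_comm, smul_comm,
    mul_comm]

include hp in
theorem polC_induction_polZ {P : PolC k p → Prop} (hz : ∀ i, P (polZ k p i))
    (hc : ∀ i, P (polC k p i)) (hs : ∀ r : k, P (algebraMap k _ r))
    (ha : ∀ f g, P f → P g → P (f + g)) (hm : ∀ f g, P f → P g → P (f * g)) (f : PolC k p) :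
    P f := by
  refine polC_induction (fun i => ?_) hc hs ha hm f
  have h0 : P (polX k p i) := by
    have h1 : polX k p i = algebraMap k _ ((paritySign p ^ i.1 : ℤ) : k) * polZ k p i := by
      rw [polZ, dif_pos i.2, map_intCast, mul_smul_comm, ← zsmul_eq_mul, smul_smul, ← mul_pow,
        paritySign_sq, one_pow, one_smul]
    rw [h1]
    exact hm _ _ (hs _) (hz _)
  rcases parity_cases hp with ⟨h, e, h1⟩ | ⟨h, e, h1⟩
  · have : polY k p i = polC k p i * polX k p i := by
      simp only [polX, cliffordFactor, if_pos h]
      rw [← mul_assoc, polC_sq (h1 i), one_mul]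
    rw [this]
    exact hm _ _ (hc i) h0
  · simpa [polX, cliffordFactor, h] using h0

include hp in
theorem polZ_polU (i : ℕ) (j : Fin (n - 1)) :
    polZ k p i * polU k p j = paritySign p • (polU k p j * polZ k p i) := by
  rcases parity_cases hp with ⟨h, e, h1⟩ | ⟨h, e, h1⟩
  · simp only [polU, if_pos h]
    rw [mul_smul_comm, mul_sub, polZ_polC hp, polZ_polC hp, smul_mul_assoc, sub_mul, ← smul_sub,
      smul_comm]
  · simp [polU, h, e]

theorem polSwap_polZ_lo (i : Fin (n - 1)) :
    polSwap hp i (polZ k p i) = paritySign p • polZ k p (i + 1) := by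
  have h1 : i.1 < n := by omega
  have h2 : i.1 + 1 < n := by omega
  rw [polZ, polZ, dif_pos h1, dif_pos h2, map_zsmul, polSwap_polX, smul_smul, ← pow_succ',
    pow_succ' _ (i.1 + 1), pow_succ', ← mul_assoc, paritySign_sq, one_mul]
  exact congrArg (fun j => paritySign p ^ i.1 • polX k p j) (simpleSwap_lo i)

theorem polSwap_polZ_hi (i : Fin (n - 1)) :
    polSwap hp i (polZ k p (i + 1)) = paritySign p • polZ k p i := by
  have h1 : i.1 < n := by omega
  have h2 : i.1 + 1 < n := by omega
  rw [polZ, polZ, dif_pos h1, dif_pos h2, map_zsmul, polSwap_polX, smul_smul, ← pow_succ']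
  exact congrArg (fun j => paritySign p ^ (i.1 + 1) • polX k p j) (simpleSwap_hi i)

theorem polSwap_polZ_of_ne {i : Fin (n - 1)} {j : ℕ} (h1 : j ≠ i.1) (h2 : j ≠ i.1 + 1) :
    polSwap hp i (polZ k p j) = polZ k p j := by
  unfold polZ
  split_ifs with h
  · rw [map_zsmul, polSwap_polX, simpleSwap_other] <;> simpa [lo, hi, Fin.ext_iff]
  · simp

/-- In the odd case u_i is a multiple of the root vector c_i - c_{i+1}, and conjugation by it is
minus the reflection s_i on the span of the c's. Thus δ_i = u_i⁻¹ 𝔡_i sees no permutation of the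
c's, only a sign. -/
theorem polSwap_polC_mul_polU (i : Fin (n - 1)) (j : Fin n) :
    polSwap hp i (polC k p j) * polU k p i = paritySign p • (polU k p i * polC k p j) := by
  rcases parity_cases hp with ⟨h, e, h1⟩ | ⟨h, e, h1⟩
  · simp only [polU, if_pos h, e]
    rw [mul_smul_comm, smul_mul_assoc, smul_comm, polSwap_polC]
    congr 1
    rw [neg_one_smul]
    by_cases hl : j = lo i
    · subst hl
      rw [simpleSwap_lo, mul_sub, sub_mul, polC_sq (h1 _), polC_sq (h1 _), neg_sub]
    by_cases hh : j = hi i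
    · subst hh
      rw [simpleSwap_hi, mul_sub, sub_mul, polC_sq (h1 _), polC_sq (h1 _), neg_sub]
    rw [simpleSwap_other hl hh, mul_sub, sub_mul, polC_anti hl, polC_anti hh]
    abel
  · simp [polC_even (h1 _)]

theorem polSwap_polU_mul_polU (i j : Fin (n - 1)) :
    polSwap hp i (polU k p j) * polU k p i = paritySign p • (polU k p i * polU k p j) := by
  rcases parity_cases hp with ⟨h, e, h1⟩ | ⟨h, e, h1⟩
  · have : polU k p j = (-1 : ℤ) ^ (j.1 + 1) • (polC k p (lo j) - polC k p (hi j)) := by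
      simp [polU, h]
    rw [this, map_zsmul, map_sub, smul_mul_assoc, sub_mul, polSwap_polC_mul_polU,
      polSwap_polC_mul_polU, mul_smul_comm, mul_sub, ← smul_sub, smul_comm]
  · simp [polU, h, e]

theorem demazure_polU (i j : Fin (n - 1)) : demazure hp i (polU k p j) = 0 := by
  unfold polU
  split_ifs
  · rw [map_zsmul]
    simp
  · simpa using demazure_algebraMap (k := k) hp i 1

theorem demazure_polX_lo (i : Fin (n - 1)) :
    demazure hp i (polX k p (lo i)) = -(paritySign p ^ i.1 • polU k p i) := by
  rcases parity_cases hp with ⟨h, e, h1⟩ | ⟨h, e, h1⟩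
  · simp only [polU, polX, cliffordFactor, if_pos h, e]
    rw [demazure_mul, demazure_polC, zero_mul, zero_add, demazure_polY, demazureY_lo, polSwap_polC,
      simpleSwap_lo, mul_sub, ← mul_assoc, polC_anti (lo_ne_hi i).symm, neg_mul, mul_assoc,
      polC_sq (h1 _), smul_smul, ← pow_add, Odd.neg_one_pow ⟨i.1, by ring⟩]
    simp only [mul_neg, mul_one, sub_neg_eq_add, neg_smul, one_smul, neg_neg]
    abel
  · have h0 : polC k p (lo i) = 0 := polC_even (h1 _)
    simp [polU, polX, cliffordFactor, h, e, demazureY_lo, h0]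

theorem demazure_polX_hi (i : Fin (n - 1)) :
    demazure hp i (polX k p (hi i)) = paritySign p ^ (i.1 + 1) • polU k p i := by
  rcases parity_cases hp with ⟨h, e, h1⟩ | ⟨h, e, h1⟩
  · simp only [polU, polX, cliffordFactor, if_pos h, e]
    rw [demazure_mul, demazure_polC, zero_mul, zero_add, demazure_polY, demazureY_hi, polSwap_polC,
      simpleSwap_hi, mul_sub, ← mul_assoc, polC_sq (h1 _), smul_smul, ← pow_add,
      Even.neg_one_pow ⟨i.1 + 1, by ring⟩]
    simp
  · have h0 : polC k p (lo i) = 0 := polC_even (h1 _)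
    simp [polU, polX, cliffordFactor, h, e, demazureY_hi, h0]

theorem demazure_polX_other {i : Fin (n - 1)} {j : Fin n} (h1 : j ≠ lo i) (h2 : j ≠ hi i) :
    demazure hp i (polX k p j) = 0 := by
  unfold polX cliffordFactor
  split_ifs <;> simp [demazure_mul, demazureY_other h1 h2]

theorem demazure_polZ_lo (i : Fin (n - 1)) : demazure hp i (polZ k p i) = -polU k p i := by
  have h1 : i.1 < n := by omega
  rw [polZ, dif_pos h1, map_zsmul]
  have := demazure_polX_lo (k := k) hp i
  rw [lo] at this
  rw [this, smul_neg, smul_smul, ← mul_pow, paritySign_sq, one_pow, one_smul]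

theorem demazure_polZ_hi (i : Fin (n - 1)) : demazure hp i (polZ k p (i + 1)) = polU k p i := by
  have h1 : i.1 + 1 < n := by omega
  rw [polZ, dif_pos h1, map_zsmul]
  have := demazure_polX_hi (k := k) hp i
  rw [hi] at this
  rw [this, smul_smul, ← mul_pow, paritySign_sq, one_pow, one_smul]

theorem demazure_polZ_of_ne {i : Fin (n - 1)} {j : ℕ} (h1 : j ≠ i.1) (h2 : j ≠ i.1 + 1) :
    demazure hp i (polZ k p j) = 0 := by
  unfold polZ
  split_ifs with h
  · rw [map_zsmul, demazure_polX_other, smul_zero] <;> simpa [lo, hi, Fin.ext_iff]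
  · simp

include hp in
theorem polU_sq (i : Fin (n - 1)) (h : ∃ i, p i = 1) : polU k p i * polU k p i = 2 := by
  rcases parity_cases hp with ⟨_, e, h1⟩ | ⟨h', _⟩
  · simp only [polU, if_pos h]
    rw [smul_mul_smul_comm, ← pow_add, Even.neg_one_pow ⟨i.1 + 1, by ring⟩, one_smul, sub_mul,
      mul_sub, mul_sub, polC_sq (h1 _), polC_sq (h1 _), polC_anti (lo_ne_hi i), ← one_add_one_eq_two]
    abel
  · exact absurd h h'

include hp in
theorem polU_polV (h2 : (∃ i, p i = 1) → (2 : k) ≠ 0) (i : Fin (n - 1)) :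
    polU k p i * polV k p i = 1 := by
  unfold polV
  split_ifs with h
  · have : (2 : PolC k p) = (2 : k) • (1 : PolC k p) := by
      rw [← one_add_one_eq_two, ← one_add_one_eq_two, add_smul, one_smul]
    rw [mul_smul_comm, polU_sq hp i h, this, smul_smul, inv_mul_cancel₀ (h2 h), one_smul]
  · simp [polU, h]

include hp in
theorem polV_polU (h2 : (∃ i, p i = 1) → (2 : k) ≠ 0) (i : Fin (n - 1)) :
    polV k p i * polU k p i = 1 := by
  have h := polU_polV (k := k) hp h2 i
  unfold polV at h ⊢
  split_ifs at h ⊢ with h'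
  · rwa [smul_mul_assoc, ← mul_smul_comm]
  · simpa using h

include hp in
theorem polU_comm {i j : Fin (n - 1)} (hij : i.1 + 1 < j.1) :
    polU k p i * polU k p j = paritySign p • (polU k p j * polU k p i) := by
  rcases parity_cases hp with ⟨h, e, h1⟩ | ⟨h, e, h1⟩
  · simp only [polU, if_pos h, e]
    rw [smul_mul_smul_comm, smul_mul_smul_comm, mul_comm, smul_comm, neg_one_smul]
    congr 1
    have e1 := polC_anti (k := k) (p := p) (i := lo i) (j := lo j) (by simp [lo]; omega)
    have e2 := polC_anti (k := k) (p := p) (i := lo i) (j := hi j) (by simp [lo, hi]; omega)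
    have e3 := polC_anti (k := k) (p := p) (i := hi i) (j := lo j) (by simp [lo, hi]; omega)
    have e4 := polC_anti (k := k) (p := p) (i := hi i) (j := hi j) (by simp [hi]; omega)
    simp only [sub_mul, mul_sub, e1, e2, e3, e4]
    abel
  · simp [polU, h, e]

include hp in
-- For neighbouring odd indices u_i u_j + u_j u_i = 2 = u_i², so u_i u_j u_i = 2u_i - 2u_j, which is
-- antisymmetric in i and j.
theorem polU_braid {i j : Fin (n - 1)} (hij : j.1 = i.1 + 1) :
    polU k p i * polU k p j * polU k p i =
      paritySign p • (polU k p j * polU k p i * polU k p j) := by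
  rcases parity_cases hp with ⟨h, e, h1⟩ | ⟨h, e, h1⟩
  · have hi2 := polU_sq (k := k) hp i h
    have hj2 := polU_sq (k := k) hp j h
    have hc : polU k p i * polU k p j + polU k p j * polU k p i = 2 := by
      simp only [polU, if_pos h]
      rw [smul_mul_smul_comm, smul_mul_smul_comm, mul_comm ((-1 : ℤ) ^ (j.1 + 1)), ← smul_add, hij,
        ← pow_add, Odd.neg_one_pow ⟨i.1 + 1, by ring⟩, show lo j = hi i from Fin.ext hij]
      have e1 := polC_anti (k := k) (p := p) (lo_ne_hi i)
      have e2 := polC_anti (k := k) (p := p) (i := lo i) (j := hi j) (by simp [lo, hi]; omega)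
      have e3 := polC_anti (k := k) (p := p) (i := hi i) (j := hi j) (by simp [hi]; omega)
      simp only [sub_mul, mul_sub, e1, e2, e3, polC_sq (h1 _), neg_one_smul,
        ← one_add_one_eq_two (R := PolC k p)]
      abel
    have t1 : polU k p i * polU k p j * polU k p i = 2 * polU k p i - 2 * polU k p j := by
      rw [eq_sub_of_add_eq hc, sub_mul, mul_assoc, hi2, mul_two (polU k p j), ← two_mul]
    have t2 : polU k p j * polU k p i * polU k p j = 2 * polU k p j - 2 * polU k p i := by
      rw [eq_sub_of_add_eq' hc, sub_mul, mul_assoc, hj2, mul_two (polU k p i), ← two_mul]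
    rw [t1, t2, e, neg_one_smul, neg_sub]
  · simp [polU, h, e]

end SignedVariables

/-! ### Relations between the Demazure operators -/

section NormalizedDemazure

variable {k : Type*} [Field k] {n : ℕ} {p : Fin n → ZMod 2} (hp : ∀ i j, p i = p j)
  (h2 : (∃ i, p i = 1) → (2 : k) ≠ 0)

/-- The Demazure operator, normalized to have value `1` at the signed variable of index `i + 1`. -/
noncomputable def divDiff (i : Fin (n - 1)) : PolC k p →ₗ[k] PolC k p :=
  LinearMap.mulLeft k (polV k p i) ∘ₗ demazure hp i

theorem divDiff_apply (i : Fin (n - 1)) (f : PolC k p) :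
    divDiff hp i f = polV k p i * demazure hp i f := rfl

include h2 in
theorem polU_mul_divDiff (i : Fin (n - 1)) (f : PolC k p) :
    polU k p i * divDiff hp i f = demazure hp i f := by
  rw [divDiff_apply, ← mul_assoc, polU_polV hp h2, one_mul]

include h2 in
/-- An identity in the polynomial algebra that governs moving `f` across `divDiff`. -/
theorem divDiff_mul_of_twist (i : Fin (n - 1)) {f f' a : PolC k p}
    (h : polSwap hp i f * polU k p i = polU k p i * f') (ha : demazure hp i f = polU k p i * a)
    (g : PolC k p) : divDiff hp i (f * g) = f' * divDiff hp i g + a * g := by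
  rw [divDiff_apply, demazure_mul, mul_add, ha, mul_assoc, ← mul_assoc, polV_polU hp h2, one_mul,
    add_comm, ← polU_mul_divDiff hp h2, ← mul_assoc (polSwap hp i f), h, mul_assoc, ← mul_assoc,
    polV_polU hp h2, one_mul]

include h2 in
theorem divDiff_polZ_lo (i : Fin (n - 1)) (g : PolC k p) :
    divDiff hp i (polZ k p i * g) = polZ k p (i + 1) * divDiff hp i g - g := by
  rw [divDiff_mul_of_twist hp h2 i (f' := polZ k p (i + 1)) (a := -1), neg_one_mul, sub_eq_add_neg]
  · rw [polSwap_polZ_lo, smul_mul_assoc, polZ_polU hp, smul_smul, paritySign_sq, one_smul]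
  · rw [demazure_polZ_lo, mul_neg_one]

include h2 in
theorem divDiff_polZ_hi (i : Fin (n - 1)) (g : PolC k p) :
    divDiff hp i (polZ k p (i + 1) * g) = polZ k p i * divDiff hp i g + g := by
  rw [divDiff_mul_of_twist hp h2 i (f' := polZ k p i) (a := 1), one_mul]
  · rw [polSwap_polZ_hi, smul_mul_assoc, polZ_polU hp, smul_smul, paritySign_sq, one_smul]
  · rw [demazure_polZ_hi, mul_one]

include h2 in
theorem divDiff_polZ_of_ne {i : Fin (n - 1)} {j : ℕ} (h : j ≠ i.1) (h' : j ≠ i.1 + 1)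
    (g : PolC k p) :
    divDiff hp i (polZ k p j * g) = paritySign p • (polZ k p j * divDiff hp i g) := by
  rw [divDiff_mul_of_twist hp h2 i (f' := paritySign p • polZ k p j) (a := 0), zero_mul, add_zero,
    smul_mul_assoc]
  · rw [polSwap_polZ_of_ne hp h h', polZ_polU hp, mul_smul_comm]
  · rw [demazure_polZ_of_ne hp h h', mul_zero]

include h2 in
theorem divDiff_polC (i : Fin (n - 1)) (j : Fin n) (g : PolC k p) :
    divDiff hp i (polC k p j * g) = paritySign p • (polC k p j * divDiff hp i g) := by
  rw [divDiff_mul_of_twist hp h2 i (f' := paritySign p • polC k p j) (a := 0), zero_mul, add_zero,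
    smul_mul_assoc]
  · rw [polSwap_polC_mul_polU, mul_smul_comm]
  · rw [demazure_polC, mul_zero]

include h2 in
theorem divDiff_polU (i j : Fin (n - 1)) (g : PolC k p) :
    divDiff hp i (polU k p j * g) = paritySign p • (polU k p j * divDiff hp i g) := by
  rw [divDiff_mul_of_twist hp h2 i (f' := paritySign p • polU k p j) (a := 0), zero_mul, add_zero,
    smul_mul_assoc]
  · rw [polSwap_polU_mul_polU, mul_smul_comm]
  · rw [demazure_polU, mul_zero]

theorem divDiff_one (i : Fin (n - 1)) : divDiff (k := k) hp i 1 = 0 := by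
  have := demazure_algebraMap (k := k) hp i 1
  rw [map_one] at this
  rw [divDiff_apply, this, mul_zero]

include hp in
/-- An operator that annihilates `1` and commutes with the generators up to a twist vanishes. -/
theorem eq_zero_of_twisted_linear {B : PolC k p →ₗ[k] PolC k p} (h1 : B 1 = 0)
    (hz : ∀ i, ∃ g, ∀ f, B (polZ k p i * f) = g * B f)
    (hc : ∀ i, ∃ g, ∀ f, B (polC k p i * f) = g * B f) : B = 0 := by
  have key : ∀ f g, B g = 0 → B (f * g) = 0 := by
    intro f
    induction f using polC_induction_polZ hp with
    | hz i =>
      intro g hg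
      obtain ⟨a, ha⟩ := hz i
      rw [ha, hg, mul_zero]
    | hc i =>
      intro g hg
      obtain ⟨a, ha⟩ := hc i
      rw [ha, hg, mul_zero]
    | hs r =>
      intro g hg
      rw [← Algebra.smul_def, map_smul, hg, smul_zero]
    | ha f f' h h' =>
      intro g hg
      rw [add_mul, map_add, h g hg, h' g hg, add_zero]
    | hm f f' h h' =>
      intro g hg
      rw [mul_assoc]
      exact h _ (h' g hg)
  ext f
  simpa using key f 1 h1

include h2 in
-- Moving a generator across δ_i twice restores it, and the two correction terms ±δ_i f cancel.
theorem divDiff_sq (i : Fin (n - 1)) (f : PolC k p) : divDiff hp i (divDiff hp i f) = 0 := by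
  have : divDiff hp i ∘ₗ divDiff hp i = (0 : PolC k p →ₗ[k] PolC k p) := by
    refine eq_zero_of_twisted_linear hp (by simp [divDiff_one]) (fun j => ?_) fun j =>
      ⟨polC k p j, fun f => ?_⟩
    · refine ⟨polZ k p j, fun f => ?_⟩
      by_cases h : j = i.1
      · subst h
        simp [divDiff_polZ_lo hp h2, divDiff_polZ_hi hp h2]
      by_cases h' : j = i.1 + 1
      · subst h'
        simp [divDiff_polZ_lo hp h2, divDiff_polZ_hi hp h2]
      simp only [LinearMap.comp_apply, divDiff_polZ_of_ne hp h2 h h', map_zsmul, smul_smul,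
        paritySign_sq, one_smul]
    · simp only [LinearMap.comp_apply, divDiff_polC hp h2, map_zsmul, smul_smul,
        paritySign_sq, one_smul]
  exact LinearMap.congr_fun this f

include h2 in
theorem divDiff_comm {i j : Fin (n - 1)} (hij : i.1 + 1 < j.1) (f : PolC k p) :
    divDiff hp i (divDiff hp j f) = paritySign p • divDiff hp j (divDiff hp i f) := by
  have : divDiff hp i ∘ₗ divDiff hp j - paritySign p • (divDiff hp j ∘ₗ divDiff hp i) =
      (0 : PolC k p →ₗ[k] PolC k p) := by
    -- The multiplier is z_a moved by both transpositions, with a factor ε for each operator whose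
    -- transposition fixes a. For c_a the two signs cancel.
    refine eq_zero_of_twisted_linear hp (by simp [divDiff_one]) (fun a => ?_) fun a =>
      ⟨polC k p a, fun f => ?_⟩
    · by_cases h : a = i.1
      · refine ⟨paritySign p • polZ k p (i.1 + 1), fun f => ?_⟩
        subst h
        rcases parity_cases hp with ⟨-, e, -⟩ | ⟨-, e, -⟩ <;>
        simp [divDiff_polZ_lo hp h2, divDiff_polZ_of_ne hp h2 (i := j) (j := i.1 + 1)
            (by omega) (by omega), divDiff_polZ_of_ne hp h2 (i := j) (j := i.1)
            (by omega) (by omega), e, mul_add, mul_sub] <;>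
        abel
      by_cases h' : a = i.1 + 1
      · refine ⟨paritySign p • polZ k p i.1, fun f => ?_⟩
        subst h'
        rcases parity_cases hp with ⟨-, e, -⟩ | ⟨-, e, -⟩ <;>
        simp [divDiff_polZ_hi hp h2, divDiff_polZ_of_ne hp h2 (i := j) (j := i.1 + 1)
            (by omega) (by omega), divDiff_polZ_of_ne hp h2 (i := j) (j := i.1)
            (by omega) (by omega), e, mul_add, mul_sub] <;>
        abel
      by_cases h3 : a = j.1
      · refine ⟨paritySign p • polZ k p (j.1 + 1), fun f => ?_⟩
        subst h3
        rcases parity_cases hp with ⟨-, e, -⟩ | ⟨-, e, -⟩ <;>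
        simp [divDiff_polZ_lo hp h2, divDiff_polZ_of_ne hp h2 (i := i) (j := j.1 + 1)
            (by omega) (by omega), divDiff_polZ_of_ne hp h2 (i := i) (j := j.1)
            (by omega) (by omega), e, mul_add, mul_sub] <;>
        abel
      by_cases h4 : a = j.1 + 1
      · refine ⟨paritySign p • polZ k p j.1, fun f => ?_⟩
        subst h4
        rcases parity_cases hp with ⟨-, e, -⟩ | ⟨-, e, -⟩ <;>
        simp [divDiff_polZ_hi hp h2, divDiff_polZ_of_ne hp h2 (i := i) (j := j.1 + 1)
            (by omega) (by omega), divDiff_polZ_of_ne hp h2 (i := i) (j := j.1)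
            (by omega) (by omega), e, mul_add, mul_sub]
      refine ⟨polZ k p a, fun f => ?_⟩
      rcases parity_cases hp with ⟨-, e, -⟩ | ⟨-, e, -⟩ <;>
      simp [divDiff_polZ_of_ne hp h2 h h', divDiff_polZ_of_ne hp h2 h3 h4, e, mul_add, mul_sub]
    · rcases parity_cases hp with ⟨-, e, -⟩ | ⟨-, e, -⟩ <;>
      simp [divDiff_polC hp h2, e, mul_add, mul_sub]
  exact sub_eq_zero.mp (LinearMap.congr_fun this f)

include h2 in
-- Both sides move z_a by the longest permutation of i, i+1, i+2, which reverses these three indices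
-- and contributes one ε. The correction terms agree, up to squares δ_i² and δ_j², which vanish.
theorem divDiff_braid {i j : Fin (n - 1)} (hij : j.1 = i.1 + 1) (f : PolC k p) :
    divDiff hp i (divDiff hp j (divDiff hp i f)) =
      paritySign p • divDiff hp j (divDiff hp i (divDiff hp j f)) := by
  have : divDiff hp i ∘ₗ divDiff hp j ∘ₗ divDiff hp i -
      paritySign p • (divDiff hp j ∘ₗ divDiff hp i ∘ₗ divDiff hp j) =
      (0 : PolC k p →ₗ[k] PolC k p) := by
    have r1 := divDiff_polZ_lo hp h2 i
    have r2 := divDiff_polZ_hi hp h2 i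
    have r3 := divDiff_polZ_lo hp h2 j
    have r4 := divDiff_polZ_hi hp h2 j
    have r5 := divDiff_polZ_of_ne hp h2 (i := i) (j := j.1 + 1) (by omega) (by omega)
    have r6 := divDiff_polZ_of_ne hp h2 (i := j) (j := i.1) (by omega) (by omega)
    rw [← hij] at r1 r2
    have r7 := divDiff_sq hp h2 i
    have r8 := divDiff_sq hp h2 j
    refine eq_zero_of_twisted_linear hp (by simp [divDiff_one]) (fun a => ?_) fun a =>
      ⟨paritySign p • polC k p a, fun f => ?_⟩
    · by_cases h : a = i.1
      · refine ⟨paritySign p • polZ k p (j.1 + 1), fun f => ?_⟩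
        subst h
        rcases parity_cases hp with ⟨-, e, -⟩ | ⟨-, e, -⟩ <;>
        simp [r1, r3, r5, r6, r7, r8, e, mul_add, mul_sub] <;>
        abel
      by_cases h' : a = j.1
      · refine ⟨paritySign p • polZ k p j, fun f => ?_⟩
        subst h'
        rcases parity_cases hp with ⟨-, e, -⟩ | ⟨-, e, -⟩ <;>
        simp [r1, r2, r3, r4, r5, r6, e, mul_add, mul_sub] <;>
        abel
      by_cases h3 : a = j.1 + 1
      · refine ⟨paritySign p • polZ k p i, fun f => ?_⟩
        subst h3
        rcases parity_cases hp with ⟨-, e, -⟩ | ⟨-, e, -⟩ <;>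
        simp [r2, r4, r5, r6, r7, r8, e, mul_add, mul_sub] <;>
        abel
      refine ⟨paritySign p • polZ k p a, fun f => ?_⟩
      rcases parity_cases hp with ⟨-, e, -⟩ | ⟨-, e, -⟩ <;>
      simp [divDiff_polZ_of_ne hp h2 (i := i) (j := a) h (by omega),
        divDiff_polZ_of_ne hp h2 (i := j) (j := a) h' h3, e, mul_add, mul_sub]
    · rcases parity_cases hp with ⟨-, e, -⟩ | ⟨-, e, -⟩ <;>
      simp [divDiff_polC hp h2, e, mul_add, mul_sub]
  exact sub_eq_zero.mp (LinearMap.congr_fun this f)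

include h2 in
theorem demazure_sq (i : Fin (n - 1)) (f : PolC k p) : demazure hp i (demazure hp i f) = 0 := by
  rw [← polU_mul_divDiff hp h2, ← polU_mul_divDiff hp h2, divDiff_polU hp h2, divDiff_sq hp h2,
    mul_zero, smul_zero, mul_zero]

include h2 in
theorem demazure_comm {i j : Fin (n - 1)} (hij : i.1 + 1 < j.1) (f : PolC k p) :
    demazure hp i (demazure hp j f) = demazure hp j (demazure hp i f) := by
  simp only [← polU_mul_divDiff hp h2]
  rw [divDiff_polU hp h2, divDiff_polU hp h2, divDiff_comm hp h2 hij]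
  simp only [mul_smul_comm, smul_smul, paritySign_sq, one_smul]
  rw [← mul_assoc, polU_comm hp hij, smul_mul_assoc, mul_assoc]

include h2 in
-- With 𝔡_i = u_i δ_i, the sign from the braid relation of the u's cancels the sign from that of the
-- δ's. This is one of the relations that make the polynomial representation well defined.
theorem demazure_braid {i j : Fin (n - 1)} (hij : j.1 = i.1 + 1) (f : PolC k p) :
    demazure hp i (demazure hp j (demazure hp i f)) =
      demazure hp j (demazure hp i (demazure hp j f)) := by
  have key : ∀ i j : Fin (n - 1), demazure hp i (demazure hp j (demazure hp i f)) =
      paritySign p • (polU k p i * polU k p j * polU k p i *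
        divDiff hp i (divDiff hp j (divDiff hp i f))) := by
    intro i j
    simp only [← polU_mul_divDiff hp h2]
    simp only [divDiff_polU hp h2, map_zsmul, mul_smul_comm, smul_smul, paritySign_sq, one_smul,
      mul_assoc]
  rw [key i j, key j i, polU_braid hp hij, divDiff_braid hp h2 hij, smul_mul_smul_comm,
    paritySign_sq, one_smul]

end NormalizedDemazure

/-! ### The polynomial representation of the NilHecke Clifford algebra -/

section PolynomialRepresentation

variable (k : Type*) [Field k] {n : ℕ} (p : Fin n → ZMod 2)

/-- The generator `𝔡_i` of the NilHecke Clifford algebra. -/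
noncomputable def nilD (i : Fin (n - 1)) : NilHeckeC k p := nilMk k p (FreeAlgebra.ι k (.d i))

variable {k p}

theorem nilMk_rel {a b : FreeAlgebra k (NilHeckeGen n)} (h : NilHeckeRel k p a b) :
    nilMk k p a = nilMk k p b :=
  RingQuot.mkAlgHom_rel k h

theorem nilMk_surjective : Function.Surjective (nilMk k p) :=
  RingQuot.mkAlgHom_surjective k (NilHeckeRel k p)

theorem nilHeckeC_induction {P : NilHeckeC k p → Prop} (hy : ∀ i, P (nilY k p i))
    (hc : ∀ i, P (nilC k p i)) (hd : ∀ i, P (nilD k p i))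
    (hs : ∀ r : k, P (algebraMap k _ r)) (ha : ∀ f g, P f → P g → P (f + g))
    (hm : ∀ f g, P f → P g → P (f * g)) (f : NilHeckeC k p) : P f := by
  obtain ⟨x, rfl⟩ := nilMk_surjective f
  induction x using FreeAlgebra.induction with
  | grade0 r => simpa using hs r
  | grade1 g =>
    cases g with
    | y i => exact hy i
    | c i => exact hc i
    | d i => exact hd i
  | mul a b h h' => simpa using hm _ _ h h'
  | add a b h h' => simpa using ha _ _ h h'

variable (k p) in
/-- The polynomial Clifford algebra maps to the NilHecke Clifford algebra. -/
noncomputable def polToNil : PolC k p →ₐ[k] NilHeckeC k p :=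
  polLift (nilY k p) (nilC k p)
    (fun i h => by simpa [nilC] using nilMk_rel (NilHeckeRel.c_even (k := k) (p := p) i h))
    (fun i h => by simpa [nilC] using nilMk_rel (NilHeckeRel.c_sq (k := k) (p := p) i h))
    (fun i j h => by simpa [nilC] using nilMk_rel (NilHeckeRel.c_anti (k := k) (p := p) i j h))
    (fun i j => by simpa [nilY] using nilMk_rel (NilHeckeRel.y_comm (k := k) (p := p) i j))
    (fun i => by simpa [nilY, nilC] using nilMk_rel (NilHeckeRel.y_c_same (k := k) (p := p) i))
    (fun i j h => by simpa [nilY, nilC] using nilMk_rel (NilHeckeRel.y_c (k := k) (p := p) i j h))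

@[simp] theorem polToNil_polY (i : Fin n) : polToNil k p (polY k p i) = nilY k p i := by
  simp [polToNil]

@[simp] theorem polToNil_polC (i : Fin n) : polToNil k p (polC k p i) = nilC k p i := by
  simp [polToNil]

theorem nilD_mul_nilC (i : Fin (n - 1)) (j : Fin n) :
    nilD k p i * nilC k p j = nilC k p (simpleSwap i j) * nilD k p i := by
  simpa [nilC, nilD] using nilMk_rel (NilHeckeRel.d_c (k := k) (p := p) i j)

theorem nilD_mul_nilY (i : Fin (n - 1)) (j : Fin n) :
    nilD k p i * nilY k p j =
      polToNil k p (demazureY k p i j) + nilY k p (simpleSwap i j) * nilD k p i := by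
  by_cases hl : j = lo i
  · subst hl
    have := nilMk_rel (NilHeckeRel.d_y_lo (k := k) (p := p) i)
    rw [demazureY_lo, simpleSwap_lo, ← sub_eq_iff_eq_add]
    simpa [nilC, nilD, nilY] using this
  by_cases hh : j = hi i
  · subst hh
    have := nilMk_rel (NilHeckeRel.d_y_hi (k := k) (p := p) i)
    rw [demazureY_hi, simpleSwap_hi, ← sub_eq_iff_eq_add]
    simpa [nilC, nilD, nilY] using this
  have := nilMk_rel (NilHeckeRel.d_y (k := k) (p := p) i j hl hh)
  rw [demazureY_other hl hh, simpleSwap_other hl hh, ← sub_eq_iff_eq_add]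
  simpa [nilC, nilD, nilY] using this

theorem nilD_sq (i : Fin (n - 1)) : nilD k p i * nilD k p i = 0 := by
  simpa [nilD] using nilMk_rel (NilHeckeRel.d_sq (k := k) (p := p) i)

theorem nilD_comm {i j : Fin (n - 1)} (h : i.1 + 1 < j.1) :
    nilD k p i * nilD k p j = nilD k p j * nilD k p i := by
  simpa [nilD] using nilMk_rel (NilHeckeRel.d_comm (k := k) (p := p) i j (Or.inl h))

theorem nilD_braid {i j : Fin (n - 1)} (h : j.1 = i.1 + 1) :
    nilD k p i * nilD k p j * nilD k p i = nilD k p j * nilD k p i * nilD k p j := by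
  simpa [nilD] using nilMk_rel (NilHeckeRel.d_braid (k := k) (p := p) i j h)

variable (hp : ∀ i j, p i = p j)

theorem nilD_mul_polToNil (i : Fin (n - 1)) (f : PolC k p) :
    nilD k p i * polToNil k p f =
      polToNil k p (demazure hp i f) + polToNil k p (polSwap hp i f) * nilD k p i := by
  induction f using polC_induction with
  | hy j => simp [nilD_mul_nilY]
  | hc j => simp [nilD_mul_nilC]
  | hs r => simp [demazure_algebraMap, Algebra.commutes]
  | ha f g h h' =>
    simp only [map_add, mul_add, h, h', add_mul]
    abel
  | hm f g h h' =>
    rw [map_mul, ← mul_assoc, h, add_mul, mul_assoc, h', demazure_mul, map_mul, map_add, map_mul,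
      map_mul]
    rw [mul_add, map_mul, mul_assoc]
    abel

variable (h2 : (∃ i, p i = 1) → (2 : k) ≠ 0)

/-- The polynomial representation. -/
noncomputable def polRep : NilHeckeC k p →ₐ[k] Module.End k (PolC k p) :=
  RingQuot.liftAlgHom k ⟨FreeAlgebra.lift k
      (fun g => match g with
        | .y i => LinearMap.mulLeft k (polY k p i)
        | .c i => LinearMap.mulLeft k (polC k p i)
        | .d i => demazure hp i), by
    intro a b hab
    ext f
    cases hab with
    | c_even i h => simp [polC_even h]
    | c_sq i h => simp [← mul_assoc, polC_sq h]
    | c_anti i j h => simp [← mul_assoc, polC_anti h]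
    | y_comm i j => simp [← mul_assoc, polY_comm i j]
    | y_c_same i => simp [← mul_assoc, polY_polC_same]
    | y_c i j h => simp [← mul_assoc, polY_polC h]
    | d_y_lo i => simp [demazure_mul, demazureY_lo, simpleSwap_lo, sub_mul, mul_assoc]
    | d_y_hi i => simp [demazure_mul, demazureY_hi, simpleSwap_hi, sub_mul, mul_assoc]
    | d_y i j h h' => simp [demazure_mul, demazureY_other h h', simpleSwap_other h h']
    | d_c i j => simp [demazure_mul]
    | d_sq i => simp [demazure_sq hp h2]
    | d_comm i j h =>
      rcases h with h | h
      · simp [demazure_comm hp h2 h]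
      · simp [demazure_comm hp h2 h]
    | d_braid i j h => simp [demazure_braid hp h2 h]⟩

@[simp] theorem polRep_nilY (i : Fin n) :
    polRep hp h2 (nilY k p i) = LinearMap.mulLeft k (polY k p i) :=
  (RingQuot.liftAlgHom_mkAlgHom_apply k _ _ _).trans (by simp)

@[simp] theorem polRep_nilC (i : Fin n) :
    polRep hp h2 (nilC k p i) = LinearMap.mulLeft k (polC k p i) :=
  (RingQuot.liftAlgHom_mkAlgHom_apply k _ _ _).trans (by simp)

@[simp] theorem polRep_nilD (i : Fin (n - 1)) : polRep hp h2 (nilD k p i) = demazure hp i :=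
  (RingQuot.liftAlgHom_mkAlgHom_apply k _ _ _).trans (by simp)

@[simp] theorem polRep_polToNil (f g : PolC k p) : polRep hp h2 (polToNil k p f) g = f * g := by
  induction f using polC_induction generalizing g with
  | hy j => simp
  | hc j => simp
  | hs r => simp [Algebra.smul_def]
  | ha f f' h h' => simp [h, h', add_mul]
  | hm f f' h h' => simp [h, h', mul_assoc]

/-- The polynomial representation commutes with right multiplication by symmetric polynomials. -/
theorem polRep_mul {s : PolC k p} (hs : s ∈ SymPolC k hp) (r : NilHeckeC k p) (f : PolC k p) :
    polRep hp h2 r (f * s) = polRep hp h2 r f * s := by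
  induction r using nilHeckeC_induction generalizing f with
  | hy j => simp [mul_assoc]
  | hc j => simp [mul_assoc]
  | hd j =>
    have : demazure hp j s = 0 := hs j
    simp [demazure_mul, this]
  | hs r => simp
  | ha f f' h h' => simp [h, h', add_mul]
  | hm f f' h h' => simp [h, h']

/-- Left ideals of elements annihilated by all `𝔡_i` are quotients of the polynomial
representation. -/
theorem mul_polToNil_mul {θ : NilHeckeC k p} (hθ : ∀ i, nilD k p i * θ = 0) (r : NilHeckeC k p)
    (f : PolC k p) :
    r * polToNil k p f * θ = polToNil k p (polRep hp h2 r f) * θ := by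
  induction r using nilHeckeC_induction generalizing f with
  | hy j => simp
  | hc j => simp
  | hd j =>
    rw [nilD_mul_polToNil hp, add_mul, mul_assoc _ (nilD k p j), hθ, mul_zero, add_zero]
    simp
  | hs r => simp [Algebra.smul_def]
  | ha r r' h h' => simp [h, h', add_mul]
  | hm r r' h h' => rw [mul_assoc r, mul_assoc r, h', ← mul_assoc, h, map_mul]; rfl

/-- The normalized operators in the NilHecke Clifford algebra. -/
noncomputable def nilDelta (k : Type*) [Field k] {n : ℕ} (p : Fin n → ZMod 2) (i : ℕ) :
    NilHeckeC k p :=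
  if h : i < n - 1 then polToNil k p (polV k p ⟨i, h⟩) * nilD k p ⟨i, h⟩ else 0

include hp h2

theorem polToNil_polU_mul_nilDelta (i : Fin (n - 1)) :
    polToNil k p (polU k p i) * nilDelta k p i = nilD k p i := by
  rw [nilDelta, dif_pos i.2, ← mul_assoc, ← map_mul, polU_polV hp h2, map_one, one_mul]

/-- The counterpart of `divDiff_mul_of_twist` inside the presented algebra; it cannot be read off
from the polynomial representation, whose faithfulness is not available here. -/
theorem nilDelta_mul_of_twist (i : Fin (n - 1)) {f f' a : PolC k p}
    (h : polSwap hp i f * polU k p i = polU k p i * f') (ha : demazure hp i f = polU k p i * a) :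
    nilDelta k p i * polToNil k p f =
      polToNil k p f' * nilDelta k p i + polToNil k p a := by
  have e : polV k p i * polSwap hp i f = f' * polV k p i := by
    calc polV k p i * polSwap hp i f
        = polV k p i * (polSwap hp i f * polU k p i) * polV k p i := by
          rw [mul_assoc, mul_assoc, polU_polV hp h2, mul_one]
      _ = f' * polV k p i := by
          rw [h, ← mul_assoc, polV_polU hp h2, one_mul]
  rw [nilDelta, dif_pos i.2, mul_assoc, nilD_mul_polToNil hp, mul_add, ← map_mul, ha, ← mul_assoc,
    ← mul_assoc, polV_polU hp h2, one_mul, ← map_mul, ← mul_assoc, ← map_mul, e, add_comm]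

theorem nilDelta_mul_polU (i j : Fin (n - 1)) :
    nilDelta k p i * polToNil k p (polU k p j) =
      paritySign p • (polToNil k p (polU k p j) * nilDelta k p i) := by
  rw [nilDelta_mul_of_twist hp h2 i (f' := paritySign p • polU k p j) (a := 0), map_zero, add_zero,
    map_zsmul, smul_mul_assoc]
  · rw [polSwap_polU_mul_polU, mul_smul_comm]
  · rw [demazure_polU, mul_zero]

omit h2 in
theorem isUnit_polU (h2 : (∃ i, p i = 1) → (2 : k) ≠ 0) (i : Fin (n - 1)) :
    IsUnit (polToNil k p (polU k p i)) :=
  IsUnit.map _ ⟨⟨_, _, polU_polV hp h2 i, polV_polU hp h2 i⟩, rfl⟩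

/-- Products of the 𝔡's are products of the u's times products of the δ's, up to ε. The u's satisfy
the commutation and braid relations up to ε and are units, so cancelling them turns the relations of
the 𝔡's into skew ones for the δ's. -/
theorem skewNilHecke_nilHeckeC :
    SkewNilHecke (paritySign p) n (fun i => polToNil k p (polZ k p i)) (nilDelta k p) := by
  have hmul : ∀ i j : Fin (n - 1), nilD k p i * nilD k p j =
      paritySign p • (polToNil k p (polU k p i * polU k p j) *
        (nilDelta k p i * nilDelta k p j)) := by
    intro i j
    rw [← polToNil_polU_mul_nilDelta hp h2 i, ← polToNil_polU_mul_nilDelta hp h2 j, mul_assoc,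
      ← mul_assoc _ _ (nilDelta k p j), nilDelta_mul_polU hp h2, map_mul, smul_mul_assoc,
      mul_smul_comm]
    simp only [mul_assoc]
  have hmul3 : ∀ i j : Fin (n - 1), nilD k p i * nilD k p j * nilD k p i =
      paritySign p • (polToNil k p (polU k p i * polU k p j * polU k p i) *
        (nilDelta k p i * nilDelta k p j * nilDelta k p i)) := by
    intro i j
    rw [hmul, ← polToNil_polU_mul_nilDelta hp h2 i, smul_mul_assoc, mul_assoc, mul_assoc,
      ← mul_assoc (nilDelta k p j), nilDelta_mul_polU hp h2, smul_mul_assoc, mul_smul_comm,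
      mul_smul_comm, mul_assoc, ← mul_assoc (nilDelta k p i), nilDelta_mul_polU hp h2,
      smul_mul_assoc, mul_smul_comm, smul_smul (paritySign p) (paritySign p), paritySign_sq,
      one_smul, map_mul _ (_ * _)]
    simp only [mul_assoc]
  -- The families are indexed by all natural numbers and vanish out of range, where the relations
  -- without constant term are trivial.
  have hne : ∀ {i : ℕ}, ¬ i < n - 1 → nilDelta k p i = 0 := fun h => dif_neg h
  constructor
  · exact paritySign_sq p
  · intro i j hj hj'
    by_cases hi : i < n - 1
    · rw [nilDelta_mul_of_twist hp h2 ⟨i, hi⟩ (f' := paritySign p • polZ k p j) (a := 0),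
        map_zero, add_zero, map_zsmul, smul_mul_assoc]
      · rw [polSwap_polZ_of_ne hp hj hj', polZ_polU hp, mul_smul_comm]
      · rw [demazure_polZ_of_ne hp hj hj', mul_zero]
    · simp [hne hi]
  · intro i hi
    rw [nilDelta_mul_of_twist hp h2 ⟨i, by omega⟩ (f' := polZ k p i) (a := 1), map_one]
    · rw [polSwap_polZ_hi hp ⟨i, by omega⟩, smul_mul_assoc, polZ_polU hp, smul_smul, paritySign_sq,
        one_smul]
    · rw [demazure_polZ_hi hp ⟨i, by omega⟩, mul_one]
  · intro i
    by_cases hi : i < n - 1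
    · have h := hmul ⟨i, hi⟩ ⟨i, hi⟩
      rw [nilD_sq] at h
      have h' := congrArg (paritySign p • ·) h
      simp only [smul_zero, smul_smul, paritySign_sq, one_smul, map_mul] at h'
      exact (((isUnit_polU hp h2 _).mul (isUnit_polU hp h2 _)).mul_right_eq_zero).mp h'.symm
    · simp [hne hi]
  · intro i j hij
    by_cases hj : j < n - 1
    · have h := nilD_comm (k := k) (p := p) (i := ⟨i, by omega⟩) (j := ⟨j, hj⟩) hij
      rw [hmul, hmul, polU_comm hp hij, map_zsmul, smul_mul_assoc, ← mul_smul_comm] at h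
      have h' := congrArg (paritySign p • ·) h
      simp only [smul_smul, paritySign_sq, one_smul, map_mul] at h'
      have h'' := ((isUnit_polU hp h2 _).mul (isUnit_polU hp h2 _)).mul_left_cancel h'
      rw [← h'', smul_smul, paritySign_sq, one_smul]
    · simp [hne hj]
  · intro i
    by_cases hj : i + 1 < n - 1
    · have h := nilD_braid (k := k) (p := p) (i := ⟨i, by omega⟩) (j := ⟨i + 1, hj⟩) rfl
      rw [hmul3, hmul3, polU_braid hp rfl, map_zsmul, smul_mul_assoc, ← mul_smul_comm] at h
      have h' := congrArg (paritySign p • ·) h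
      simp only [smul_smul, paritySign_sq, one_smul, map_mul] at h'
      have h'' := (((isUnit_polU hp h2 _).mul (isUnit_polU hp h2 _)).mul
        (isUnit_polU hp h2 _)).mul_left_cancel h'
      rw [← h'', smul_smul, paritySign_sq, one_smul]
    · simp [hne hj]

end PolynomialRepresentation

/-! ### Complete symmetric polynomials -/

theorem paritySign_pow_congr {n : ℕ} {p : Fin n → ZMod 2} {a b : ℕ} (h : a % 2 = b % 2) :
    paritySign p ^ a = paritySign p ^ b := by
  rw [← Nat.mod_add_div a 2, ← Nat.mod_add_div b 2, h, pow_add, pow_add, pow_mul, pow_mul, pow_two,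
    paritySign_sq, one_pow, one_pow]

/-! ### The scalars γ and κ for constant parity -/

section Kappa

variable {A : Type*} [Ring A] {n : ℕ} {p : Fin n → ZMod 2} (hp : ∀ i j, p i = p j) (c : Fin n → A)

include hp

theorem gammaUp_eq (i : Fin n) : gammaUp p c i = cliffordFactor p c i := by
  rcases parity_cases hp with ⟨h, -, h1⟩ | ⟨h, -, h1⟩
  · rw [cliffordFactor, if_pos h, gammaUp, if_pos ⟨h1 i, fun j _ => h1 j⟩]
  · rw [cliffordFactor, if_neg h, gammaUp, if_neg (by simp [h1])]

theorem gammaDown_eq (i : Fin n) : gammaDown p c i = paritySign p • cliffordFactor p c i := by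
  rcases parity_cases hp with ⟨h, e, h1⟩ | ⟨h, e, h1⟩
  · rw [cliffordFactor, if_pos h, gammaDown, if_pos ⟨h1 i, fun j _ => h1 j⟩, e, neg_one_smul]
  · rw [cliffordFactor, if_neg h, gammaDown, if_neg (by simp [h1]), e, one_smul]

theorem cliffordFactor_sq (hc : ∀ i, p i = 1 → c i * c i = 1) (i : Fin n) :
    cliffordFactor p c i * cliffordFactor p c i = 1 := by
  rcases parity_cases hp with ⟨h, e, h1⟩ | ⟨h, e, h1⟩
  · simp [cliffordFactor, h, hc i (h1 i)]
  · simp [cliffordFactor, h]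

/-- Each inner factor γ_{j,j-1} γ_{j,j+1} equals ε because c_j² = 1. There are b - a - 1 of them,
and the last factor γ_{b,b-1} contributes one more ε. -/
theorem kappa_eq (hc : ∀ i, p i = 1 → c i * c i = 1) {a b : Fin n} (hab : a ≤ b) :
    kappa p c a b = paritySign p ^ (b.1 - a.1) • cliffordFactor p c b := by
  unfold kappa
  split_ifs with h
  · rw [h, gammaUp_eq hp, Nat.sub_self, pow_zero, one_smul]
  · have h1 : ∀ j, gammaDown p c j * gammaUp p c j = paritySign p • (1 : A) := by
      intro j
      rw [gammaDown_eq hp, gammaUp_eq hp, smul_mul_assoc, cliffordFactor_sq hp c hc]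
    have h3 : ((List.finRange n).filter (fun j => a < j ∧ j < b)).length = b.1 - a.1 - 1 := by
      rw [← Fin.card_Ioo, ← List.toFinset_card_of_nodup ((List.nodup_finRange n).filter _)]
      congr 1
      ext j
      simp
    have hlt : a.1 < b.1 := lt_of_le_of_ne hab (fun e => h (Fin.ext e))
    simp only [h1]
    rw [List.map_const', List.prod_replicate, h3, gammaDown_eq hp, smul_pow, one_pow,
      smul_mul_smul_comm, one_mul, ← pow_succ]
    congr 2
    omega

theorem kappaTilde_eq (hc : ∀ i, p i = 1 → c i * c i = 1) {a b : Fin n} (hab : a ≤ b) :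
    kappaTilde p c a b = paritySign p ^ (b.1 - a.1) • (1 : A) := by
  rw [kappaTilde, kappa_eq hp c hc hab, kappa_eq hp c hc le_rfl, Nat.sub_self, pow_zero, one_smul,
    smul_mul_assoc, cliffordFactor_sq hp c hc]

end Kappa

/-! ### Complete against elementary polynomials in noncommuting variables -/

section Newton

variable {A : Type*} [Ring A] (z : ℕ → A)

/-- The complete symmetric polynomial of degree `r` in `z 0, …, z (j - 1)`, with the indices of each
monomial decreasing. -/
def descComplete : ℕ → ℕ → A
  | 0, 0 => 1
  | 0, _ + 1 => 0
  | _ + 1, 0 => 1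
  | j + 1, r + 1 => z j * descComplete (j + 1) r + descComplete j (r + 1)

/-- The elementary symmetric polynomial of degree `m` in `z 0, …, z (j - 1)`, with the indices of
each monomial increasing. -/
def ascElem : ℕ → ℕ → A
  | _, 0 => 1
  | 0, _ + 1 => 0
  | j + 1, m + 1 => ascElem j (m + 1) + ascElem j m * z j

@[simp] theorem descComplete_zero (j : ℕ) : descComplete z j 0 = 1 := by
  cases j <;> rw [descComplete]

@[simp] theorem ascElem_zero (j : ℕ) : ascElem z j 0 = 1 := by
  cases j <;> rw [ascElem]

theorem ascElem_of_lt {j m : ℕ} (h : j < m) : ascElem z j m = 0 := by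
  induction j generalizing m with
  | zero =>
    obtain ⟨m, rfl⟩ := Nat.exists_eq_succ_of_ne_zero h.ne'
    rw [ascElem]
  | succ j ih =>
    obtain ⟨m, rfl⟩ := Nat.exists_eq_succ_of_ne_zero (by omega : m ≠ 0)
    rw [ascElem, ih (by omega), ih (by omega), zero_mul, add_zero]

open PowerSeries in
-- With a central variable X, adding z_j multiplies the complete series on the left by (1 - X z_j)⁻¹
-- and the signed elementary series on the right by 1 - X z_j. The opposite orders of the indices
-- are what makes the product telescope.
theorem mk_descComplete_mul_mk_ascElem (j : ℕ) :
    PowerSeries.mk (descComplete z j) * PowerSeries.mk (fun m => (-1) ^ m * ascElem z j m) = 1 := by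
  induction j with
  | zero =>
    have h1 : PowerSeries.mk (descComplete z 0) = 1 := by
      ext (_ | r) <;> simp [descComplete, PowerSeries.coeff_one]
    have h2 : PowerSeries.mk (fun m => (-1) ^ m * ascElem z 0 m) = 1 := by
      ext (_ | r) <;> simp [ascElem, PowerSeries.coeff_one]
    rw [h1, h2, one_mul]
  | succ j ih =>
    set a : A⟦X⟧ := 1 - X * C (z j) with ha
    have h1 : a * PowerSeries.mk (descComplete z (j + 1)) = PowerSeries.mk (descComplete z j) := by
      ext (_ | r)
      · simp [ha, sub_mul, mul_assoc]
      · simp [ha, sub_mul, mul_assoc, descComplete, PowerSeries.coeff_succ_X_mul]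
    have h2 : PowerSeries.mk (fun m => (-1) ^ m * ascElem z (j + 1) m) =
        PowerSeries.mk (fun m => (-1) ^ m * ascElem z j m) * a := by
      ext (_ | r)
      · simp [ha, mul_sub, ← mul_assoc, ← PowerSeries.commute_X _ |>.eq]
      · rw [ha, mul_sub, mul_one, ← mul_assoc, map_sub, PowerSeries.coeff_mul_C,
          PowerSeries.coeff_succ_mul_X]
        simp [ascElem, pow_succ, mul_add, mul_assoc, sub_eq_add_neg]
    set Q := PowerSeries.mk (descComplete z (j + 1)) *
      PowerSeries.mk (fun m => (-1) ^ m * ascElem z (j + 1) m) with hQ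
    have h3 : a * Q = a := by
      rw [hQ, ← mul_assoc, h1, h2, ← mul_assoc, ih, one_mul]
    have h4 : Q - 1 = X * (C (z j) * (Q - 1)) := by
      have : a * (Q - 1) = 0 := by rw [mul_sub, h3, mul_one, sub_self]
      rwa [ha, sub_mul, one_mul, mul_assoc, sub_eq_zero] at this
    -- Q - 1 equals X z_j (Q - 1), so its coefficients vanish one after another; this replaces
    -- inverting 1 - X z_j.
    have h5 : ∀ r, coeff r (Q - 1) = 0 := by
      intro r
      induction r with
      | zero => rw [h4]; simp
      | succ r ih => rw [h4, PowerSeries.coeff_succ_X_mul, PowerSeries.coeff_C_mul, ih, mul_zero]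
    exact sub_eq_zero.mp (PowerSeries.ext fun r => by rw [h5, map_zero])

theorem descComplete_succ_eq_sum (j r : ℕ) :
    descComplete z j (r + 1) =
      ∑ i ∈ Finset.range (r + 1), (-1) ^ i * (descComplete z j (r - i) * ascElem z j (i + 1)) := by
  have h := congrArg (PowerSeries.coeff (r + 1)) (mk_descComplete_mul_mk_ascElem z j)
  rw [PowerSeries.coeff_mul, Finset.Nat.sum_antidiagonal_eq_sum_range_succ_mk,
    ← Finset.sum_range_reflect, Finset.sum_range_succ'] at h
  simp only [PowerSeries.coeff_mk, PowerSeries.coeff_one, Nat.succ_ne_zero, if_false, Nat.succ_eq_add_one] at h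
  simp only [Nat.add_sub_cancel, Nat.sub_zero, Nat.sub_self, pow_zero, ascElem_zero,
    mul_one] at h
  rw [eq_neg_of_add_eq_zero_right h, ← Finset.sum_neg_distrib]
  refine Finset.sum_congr rfl fun i hi => ?_
  have hi' : i < r + 1 := Finset.mem_range.mp hi
  rw [show r + 1 - (i + 1) = r - i by omega, show r + 1 - (r - i) = i + 1 by omega,
    pow_succ, mul_neg_one, neg_mul, mul_neg, neg_neg, ← mul_assoc, ← mul_assoc,
    ((Commute.neg_one_left (descComplete z j (r - i))).pow_left i).eq]

end Newton

/-! ### Powers of the matrix of elementary polynomials -/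

section CompleteSym

variable {k : Type*} [Field k] {n : ℕ} {p : Fin n → ZMod 2} (hp : ∀ i j, p i = p j)

include hp

/-- Since κ_{m,j} y_j = ε^m z_j with indices from 0, passing from degree m to m + 1 costs ε^m, and
these exponents add up to a binomial coefficient. -/
theorem elemSym_eq (j m : ℕ) :
    elemSym k p j m = paritySign p ^ (m.choose 2) • ascElem (polZ k p) j m := by
  induction j generalizing m with
  | zero => cases m <;> simp [elemSym, ascElem]
  | succ j ih =>
    cases m with
    | zero => simp [elemSym]
    | succ m =>
      rw [elemSym, ascElem, ih, ih, smul_add]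
      congr 1
      split_ifs with h
      · rw [kappa_eq hp _ (fun i hi => polC_sq hi) (by simpa using h.1), polZ, dif_pos h.2, polX]
        simp only [mul_smul_comm, smul_mul_assoc, smul_smul, ← pow_add, mul_assoc]
        congr 1
        have h2 : (m + 1).choose 2 = m + m.choose 2 := by
          rw [Nat.choose_succ_succ' m 1, Nat.choose_one_right]
        exact paritySign_pow_congr (by omega)
      · rcases not_and_or.mp h with h | h
        · rw [ascElem_of_lt _ (by omega), zero_mul, smul_zero]
        · rw [polZ, dif_neg h, mul_zero, smul_zero]

/-- The whole first row is needed for the induction. Multiplying by the superdiagonal only shifts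
it, with a sign; multiplying by the first column is the convolution of `descComplete_succ_eq_sum`,
in which the signs ε cancel in pairs. -/
theorem symMatrix_pow_zero [NeZero n] (r : ℕ) (j : Fin n) :
    (symMatrix k p ^ r) 0 j = if j.1 ≤ r then
      paritySign p ^ ((j.1 + 1).choose 2) • descComplete (polZ k p) n (r - j.1) else 0 := by
  have hc : ∀ m : ℕ, (m + 1).choose 2 = m + m.choose 2 := fun m => by
    rw [Nat.choose_succ_succ' m 1, Nat.choose_one_right]
  induction r generalizing j with
  | zero =>
    rw [pow_zero, Matrix.one_apply]
    by_cases hj : j = 0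
    · subst hj
      simp
    · have : j.1 ≠ 0 := fun e => hj (Fin.ext e)
      rw [if_neg (Ne.symm hj), if_neg (by omega)]
  | succ r ih =>
    rw [pow_succ, Matrix.mul_apply]
    simp only [ih]
    by_cases hj : j = 0
    · subst hj
      simp only [symMatrix, Matrix.of_apply, if_true, elemSym_eq hp]
      rw [Fin.sum_univ_eq_sum_range (fun i => (if i ≤ r then paritySign p ^ ((i + 1).choose 2) •
        descComplete (polZ k p) n (r - i) else 0) * ((-1) ^ i * (paritySign p ^
        ((i + 1).choose 2) • ascElem (polZ k p) n (i + 1)))) n]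
      simp only [Fin.val_zero, Nat.zero_le, if_true, Nat.sub_zero, zero_add]
      rw [descComplete_succ_eq_sum, Nat.choose_eq_zero_of_lt (by omega : 1 < 2), pow_zero, one_smul]
      set F : ℕ → PolC k p := fun i => (-1) ^ i *
        (descComplete (polZ k p) n (r - i) * ascElem (polZ k p) n (i + 1)) with hF
      have e1 : ∀ i, (if i ≤ r then paritySign p ^ ((i + 1).choose 2) •
          descComplete (polZ k p) n (r - i) else 0) * ((-1) ^ i * (paritySign p ^
          ((i + 1).choose 2) • ascElem (polZ k p) n (i + 1))) = if i < r + 1 then F i else 0 := by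
        intro i
        by_cases hi : i ≤ r
        · rw [if_pos hi, if_pos (by omega), mul_smul_comm, smul_mul_smul_comm, ← mul_pow,
            paritySign_sq, one_pow, one_smul, ← mul_assoc,
            ← ((Commute.neg_one_left (descComplete (polZ k p) n (r - i))).pow_left i).eq, mul_assoc]
        · rw [if_neg hi, if_neg (by omega), zero_mul]
      -- The matrix product has n terms and the convolution r + 1; they agree because elementary
      -- polynomials of degree above n vanish.
      have e2 : ∀ i, i ∉ Finset.range n → F i = 0 := by
        intro i hi
        rw [hF]
        simp only
        rw [ascElem_of_lt _ (by simpa [Nat.lt_succ_iff] using hi), mul_zero, mul_zero]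
      simp only [e1]
      rw [← Finset.sum_filter, ← Finset.sum_filter_of_ne
        (s := Finset.range (r + 1)) (p := fun i => i ∈ Finset.range n)
        (fun i _ h => by by_contra hi; exact h (e2 i hi))]
      refine Finset.sum_congr ?_ fun _ _ => rfl
      ext i
      simp [and_comm]
    · have hj0 : j.1 ≠ 0 := fun e => hj (Fin.ext e)
      rw [Finset.sum_eq_single (⟨j.1 - 1, by omega⟩ : Fin n)]
      · have e1 : symMatrix k p ⟨j.1 - 1, by omega⟩ j = kappaTilde p (polC k p) 0 j := by
          simp only [symMatrix, Matrix.of_apply]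
          rw [if_neg hj, if_pos (by omega)]
        rw [e1, kappaTilde_eq hp _ (fun i hi => polC_sq hi) (Fin.zero_le _), mul_smul_comm,
          mul_one]
        simp only [Fin.val_zero, Nat.sub_zero]
        by_cases hr : j.1 ≤ r + 1
        · rw [if_pos (by omega), if_pos hr, smul_smul, ← pow_add, Nat.sub_add_cancel (by omega),
            hc, show r - (j.1 - 1) = r + 1 - j.1 by omega]
        · rw [if_neg (by omega), if_neg hr, smul_zero]
      · intro i _ hi
        have e1 : symMatrix k p i j = 0 := by
          simp only [symMatrix, Matrix.of_apply]
          rw [if_neg hj, if_neg fun e => hi (Fin.ext (by simp only; omega))]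
        rw [e1, mul_zero]
      · intro h
        exact absurd (Finset.mem_univ _) h

theorem completeSym_eq [NeZero n] (r : ℕ) :
    completeSym k p r = descComplete (polZ k p) n r := by
  rw [completeSym, symMatrix_pow_zero hp]
  simp

end CompleteSym

/-! ### Reversal of the variables -/

section Reversal

variable (k : Type*) [Field k] {n : ℕ} {p : Fin n → ZMod 2} (hp : ∀ i j, p i = p j)

/-- The automorphism of the polynomial Clifford algebra that reverses the order of the indices. -/
noncomputable def polRev : PolC k p →ₐ[k] PolC k p :=
  polLift (fun j => polY k p j.rev) (fun j => polC k p j.rev)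
    (fun j h => polC_even ((hp _ j).trans h))
    (fun j h => polC_sq ((hp _ j).trans h))
    (fun _ _ h => polC_anti (Fin.rev_injective.ne h))
    (fun _ _ => polY_comm _ _)
    (fun _ => polY_polC_same _)
    (fun _ _ h => polY_polC (Fin.rev_injective.ne h))

variable {k}

@[simp] theorem polRev_polY (i : Fin n) : polRev k hp (polY k p i) = polY k p i.rev := by
  simp [polRev]

@[simp] theorem polRev_polC (i : Fin n) : polRev k hp (polC k p i) = polC k p i.rev := by
  simp [polRev]

@[simp] theorem polRev_polRev (f : PolC k p) : polRev k hp (polRev k hp f) = f := by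
  induction f using polC_induction with
  | hy i => simp
  | hc i => simp
  | hs r => simp
  | ha f g h h' => simp [h, h']
  | hm f g h h' => simp [h, h']

theorem rev_lo (i : Fin (n - 1)) : (lo i).rev = hi i.rev := by
  ext; simp [lo, hi, Fin.val_rev]; omega

theorem rev_hi (i : Fin (n - 1)) : (hi i).rev = lo i.rev := by
  ext; simp [lo, hi, Fin.val_rev]; omega

theorem rev_simpleSwap (i : Fin (n - 1)) (j : Fin n) :
    (simpleSwap i j).rev = simpleSwap i.rev j.rev := by
  by_cases hl : j = lo i
  · subst hl
    rw [simpleSwap_lo, rev_lo, rev_hi, simpleSwap_hi]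
  by_cases hh : j = hi i
  · subst hh
    rw [simpleSwap_hi, rev_lo, rev_hi, simpleSwap_lo]
  · rw [simpleSwap_other hl hh, simpleSwap_other]
    · rw [← rev_hi]; exact Fin.rev_injective.ne hh
    · rw [← rev_lo]; exact Fin.rev_injective.ne hl

theorem polSwap_polRev (i : Fin (n - 1)) (f : PolC k p) :
    polSwap hp i (polRev k hp f) = polRev k hp (polSwap hp i.rev f) := by
  induction f using polC_induction with
  | hy j => simp [rev_simpleSwap]
  | hc j => simp [rev_simpleSwap]
  | hs r => simp
  | ha f g h h' => simp [h, h']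
  | hm f g h h' => simp [h, h']

theorem polRev_demazureY (i : Fin (n - 1)) (j : Fin n) :
    polRev k hp (demazureY k p i.rev j) = -demazureY k p i j.rev := by
  by_cases hl : j = lo i.rev
  · subst hl
    rw [demazureY_lo, rev_lo, Fin.rev_rev, demazureY_hi]
    simp only [map_sub, map_neg, map_one, map_mul, polRev_polC, rev_lo, rev_hi, Fin.rev_rev]
    rw [polC_anti (lo_ne_hi i).symm]
    abel
  by_cases hh : j = hi i.rev
  · subst hh
    rw [demazureY_hi, rev_hi, Fin.rev_rev, demazureY_lo]
    simp only [map_sub, map_one, map_mul, polRev_polC, rev_lo, rev_hi, Fin.rev_rev]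
    rw [polC_anti (lo_ne_hi i).symm]
    abel
  · rw [demazureY_other hl hh, demazureY_other, map_zero, neg_zero]
    · intro e
      exact hh (by rw [← Fin.rev_rev j, e, rev_lo])
    · intro e
      exact hl (by rw [← Fin.rev_rev j, e, rev_hi])

/-- Reversal exchanges the two neighbours, hence the constants ±1 in the values of 𝔡_i, and swaps
the anticommuting factors of c_i c_{i+1}. Both effects are the same sign, so the kernels are
preserved. -/
theorem demazure_polRev (i : Fin (n - 1)) (f : PolC k p) :
    demazure hp i (polRev k hp f) = -polRev k hp (demazure hp i.rev f) := by
  induction f using polC_induction with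
  | hy j => simp [polRev_demazureY]
  | hc j => simp
  | hs r => simp [demazure_algebraMap]
  | ha f g h h' => simp only [map_add, h, h', neg_add]
  | hm f g h h' =>
    rw [map_mul, demazure_mul, demazure_mul, h, h', polSwap_polRev, map_add, map_mul, map_mul]
    simp only [neg_mul, mul_neg, neg_add]

theorem polRev_mem {f : PolC k p} (hf : f ∈ SymPolC k hp) : polRev k hp f ∈ SymPolC k hp := by
  intro i
  have : demazure hp i.rev f = 0 := hf i.rev
  rw [demazure_polRev, this, map_zero, neg_zero]

theorem polRev_polZ {i : ℕ} (hi : i < n) :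
    polRev k hp (polZ k p i) = paritySign p ^ (n - 1) • polZ k p (n - 1 - i) := by
  have hx : ∀ j, polRev k hp (polX k p j) = polX k p j.rev := by
    intro j
    unfold polX cliffordFactor
    split_ifs <;> simp
  rw [polZ, polZ, dif_pos hi, dif_pos (by omega), map_zsmul, hx, smul_smul, ← pow_add,
    show n - 1 + (n - 1 - i) = i + 2 * (n - 1 - i) by omega, pow_add, pow_mul, pow_two,
    paritySign_sq, one_pow, mul_one]
  exact congrArg (fun j => paritySign p ^ i • polX k p j) (Fin.ext (by simp [Fin.val_rev]; omega))

theorem polRev_complete {d : ℕ} (hd : d < n) (r : ℕ) :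
    polRev k hp (complete (polZ k p) (n - 1) d r) =
      paritySign p ^ ((n - 1) * r) • descComplete (polZ k p) (d + 1) r := by
  induction d generalizing r with
  | zero =>
    have : ∀ r, descComplete (polZ k p) 1 r = polZ k p 0 ^ r := by
      intro r
      induction r with
      | zero => simp
      | succ r ih => rw [descComplete, ih, descComplete, add_zero, pow_succ']
    rw [complete, map_pow, polRev_polZ hp (by omega), Nat.sub_self, smul_pow, ← pow_mul, this]
  | succ d ihd =>
    induction r with
    | zero => simp
    | succ r ih =>
      rw [complete_succ_succ, descComplete, map_add, map_mul, ih, ihd (by omega),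
        polRev_polZ hp (by omega), smul_mul_smul_comm, ← pow_add, smul_add,
        show n - 1 - (n - 1 - (d + 1)) = d + 1 by omega,
        show n - 1 + (n - 1) * r = (n - 1) * (r + 1) by ring]

/-- The bridge between the decreasing monomials from the matrix and the increasing ones from the
δ's. -/
theorem polRev_completeSym [NeZero n] (r : ℕ) :
    polRev k hp (completeSym k p r) =
      paritySign p ^ ((n - 1) * r) • complete (polZ k p) (n - 1) (n - 1) r := by
  have hn : n ≠ 0 := NeZero.ne n
  have h := polRev_complete (k := k) hp (d := n - 1) (by omega) r
  rw [Nat.sub_add_cancel (by omega), ← completeSym_eq hp] at h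
  have h' := congrArg (fun f => paritySign p ^ ((n - 1) * r) • polRev k hp f) h
  simp only [polRev_polRev, map_zsmul, smul_smul, ← mul_pow, paritySign_sq, one_pow,
    one_smul] at h'
  exact h'.symm

end Reversal

/-! ### The NilHecke Clifford algebra as a matrix algebra -/

/-- Dual bases that exhibit the polynomial representation as free over the symmetric
polynomials. -/
structure NilDualBasis {k : Type*} [Field k] {n : ℕ} {p : Fin n → ZMod 2} (hp : ∀ i j, p i = p j)
    (h2 : (∃ i, p i = 1) → (2 : k) ≠ 0) (ι : Type*) [Fintype ι] [DecidableEq ι] where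
  /-- The basis. -/
  b : ι → NilHeckeC k p
  /-- The coordinates. -/
  θ : ι → NilHeckeC k p
  nilD_mul : ∀ w i, nilD k p i * θ w = 0
  sum_mul : ∑ w, b w * θ w = 1
  apply_apply : ∀ s ∈ SymPolC k hp, ∀ v w,
    polRep hp h2 (θ v) (polRep hp h2 (b w) s) = if v = w then s else 0

/-! ### The dual basis and the symmetry of complete polynomials -/

section PolynomialModule

variable {k : Type*} [Field k] {n : ℕ} {p : Fin n → ZMod 2} (hp : ∀ i j, p i = p j)
  (h2 : (∃ i, p i = 1) → (2 : k) ≠ 0)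

/-- The polynomial representation as a module structure. -/
@[reducible] noncomputable def polModule : Module (NilHeckeC k p) (PolC k p) :=
  Module.compHom (PolC k p) (polRep hp h2).toRingHom

theorem polRep_nilDelta_eq_zero_iff (i : Fin (n - 1)) (f : PolC k p) :
    polRep hp h2 (nilDelta k p i) f = 0 ↔ demazure hp i f = 0 := by
  constructor
  · intro h
    have := congrArg (fun r => polRep hp h2 r f) (polToNil_polU_mul_nilDelta hp h2 i)
    simp only [map_mul, Module.End.mul_apply, h, map_zero, polRep_nilD] at this
    exact this.symm
  · intro h
    rw [nilDelta, dif_pos i.2, map_mul, Module.End.mul_apply, polRep_nilD, h, map_zero]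

theorem mem_symPolC_iff_killed (f : PolC k p) :
    letI := polModule hp h2
    f ∈ SymPolC k hp ↔ Killed (nilDelta k p) n f := by
  let := polModule hp h2
  constructor
  · intro h i hi
    exact (polRep_nilDelta_eq_zero_iff hp h2 ⟨i, by omega⟩ f).mpr (h ⟨i, by omega⟩)
  · intro h i
    exact (polRep_nilDelta_eq_zero_iff hp h2 i f).mp (h i (by omega))

theorem nonempty_nilDualBasis : Nonempty (NilDualBasis hp h2 (Fin n.factorial)) := by
  let := polModule hp h2
  obtain ⟨b, θ, h1, h3, h4⟩ :=
    (skewNilHecke_nilHeckeC hp h2).exists_dual_basis (PolC k p) le_rfl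
  refine ⟨⟨b, θ, fun w i => ?_, h3, fun s hs => h4 s ((mem_symPolC_iff_killed hp h2 s).mp hs)⟩⟩
  rw [← polToNil_polU_mul_nilDelta hp h2, mul_assoc]
  have : nilDelta k p i * θ w = 0 := h1 w i (by omega)
  rw [this, mul_zero]

/-- The constant 1 is symmetric, so `descent_smul_pow` applies to it with all n variables. This form
links the complete polynomials to powers of the cyclotomic generator. -/
theorem complete_eq_polRep [NeZero n] (r : ℕ) :
    complete (polZ k p) (n - 1) (n - 1) r =
      polRep hp h2 (descent (nilDelta k p) (n - 1) (n - 1) *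
        polToNil k p (polZ k p (n - 1)) ^ (r + (n - 1))) 1 := by
  let := polModule hp h2
  have hn : n ≠ 0 := NeZero.ne n
  have h1 : Killed (nilDelta k p) (n - 1 + 1) (1 : PolC k p) := by
    rw [Nat.sub_add_cancel (by omega)]
    exact (mem_symPolC_iff_killed hp h2 1).mp (one_mem _)
  have h := (skewNilHecke_nilHeckeC hp h2).descent_smul_pow (d := n - 1) le_rfl (by omega) h1
    (r + (n - 1))
  rw [if_neg (by omega), Nat.add_sub_cancel, smul_smul] at h
  have hc : ∀ d r, complete (fun i => polToNil k p (polZ k p i)) (n - 1) d r =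
      polToNil k p (complete (polZ k p) (n - 1) d r) := by
    intro d
    induction d with
    | zero => intro r; simp [complete]
    | succ d ihd =>
      intro r
      induction r with
      | zero => simp
      | succ r ih => rw [complete_succ_succ, complete_succ_succ, ih, ihd, map_add, map_mul]
  have h' := polRep_polToNil hp h2 (complete (polZ k p) (n - 1) (n - 1) r) 1
  rw [mul_one, ← hc] at h'
  exact h'.symm.trans h.symm

include h2 in
theorem complete_mem [NeZero n] (r : ℕ) :
    complete (polZ k p) (n - 1) (n - 1) r ∈ SymPolC k hp := by
  let := polModule hp h2
  have hn : n ≠ 0 := NeZero.ne n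
  have h1 : Killed (nilDelta k p) n (1 : PolC k p) :=
    (mem_symPolC_iff_killed hp h2 1).mp (one_mem _)
  have hs := skewNilHecke_nilHeckeC hp h2
  have h3 : Killed (nilDelta k p) (n - 1) (polToNil k p (polZ k p (n - 1)) ^ (r + (n - 1)) •
      (1 : PolC k p)) := hs.killed_pow (fun i hi => h1 i (by omega)) _
  -- The product has full length, so the extra vanishing hypothesis is void.
  have h4 := hs.killed_descent (d := n - 1) le_rfl h3 (by omega)
  rw [Nat.sub_add_cancel (by omega), smul_smul] at h4
  rw [complete_eq_polRep hp h2]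
  exact (mem_symPolC_iff_killed hp h2 _).mpr h4

include h2 in
theorem completeSym_mem [NeZero n] (r : ℕ) : completeSym k p r ∈ SymPolC k hp := by
  rw [← polRev_polRev hp (completeSym k p r), polRev_completeSym hp]
  exact polRev_mem hp (zsmul_mem (complete_mem hp h2 r) _)

end PolynomialModule

/-! ### Matrix coefficients and matrix units -/

namespace NilDualBasis

variable {k : Type*} [Field k] {n : ℕ} {p : Fin n → ZMod 2} {hp : ∀ i j, p i = p j}
  {h2 : (∃ i, p i = 1) → (2 : k) ≠ 0} {ι : Type*} [Fintype ι] [DecidableEq ι]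
  (B : NilDualBasis hp h2 ι)

/-- The coordinates of a polynomial. -/
noncomputable def coordAt (v : ι) : PolC k p →ₗ[k] SymPolC k hp :=
  (polRep hp h2 (B.θ v)).codRestrict (Subalgebra.toSubmodule (SymPolC k hp)) fun f i => by
    rw [← polRep_nilD hp h2, ← Module.End.mul_apply, ← map_mul, B.nilD_mul, map_zero,
      LinearMap.zero_apply]

theorem coe_coordAt (v : ι) (f : PolC k p) : (B.coordAt v f : PolC k p) = polRep hp h2 (B.θ v) f :=
  rfl

theorem coordAt_mul (v : ι) (f : PolC k p) (s : SymPolC k hp) :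
    B.coordAt v (f * s) = B.coordAt v f * s :=
  Subtype.ext (polRep_mul hp h2 s.2 _ _)

theorem sum_coordAt (f : PolC k p) :
    ∑ w, polRep hp h2 (B.b w) 1 * (B.coordAt w f : PolC k p) = f := by
  have h : ∀ w, polRep hp h2 (B.b w) 1 * (B.coordAt w f : PolC k p) =
      polRep hp h2 (B.b w * B.θ w) f := by
    intro w
    rw [← polRep_mul hp h2 (B.coordAt w f).2, one_mul, map_mul]
    rfl
  simp only [h]
  rw [← LinearMap.sum_apply, ← map_sum, B.sum_mul, map_one, Module.End.one_apply]

/-- The matrix of an operator in the dual basis. -/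
noncomputable def toMatrix : NilHeckeC k p →ₐ[k] Matrix ι ι (SymPolC k hp) where
  toFun r := Matrix.of fun v w => B.coordAt v (polRep hp h2 r (polRep hp h2 (B.b w) 1))
  map_one' := by
    ext v w
    rw [Matrix.of_apply, coe_coordAt, map_one, Module.End.one_apply,
      B.apply_apply 1 (one_mem _), Matrix.one_apply]
    split_ifs <;> rfl
  map_mul' r s := by
    ext v w
    rw [Matrix.of_apply, Matrix.mul_apply, map_mul, Module.End.mul_apply,
      ← B.sum_coordAt (polRep hp h2 s (polRep hp h2 (B.b w) 1)), map_sum, map_sum]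
    refine congrArg _ (Finset.sum_congr rfl fun u _ => ?_)
    rw [polRep_mul hp h2 (SetLike.coe_mem _), coordAt_mul, Matrix.of_apply, Matrix.of_apply]
  map_zero' := by
    ext v w
    simp
  map_add' r s := by
    ext v w
    simp
  commutes' c := by
    ext v w
    rw [Matrix.of_apply, coe_coordAt, AlgHom.commutes, Module.algebraMap_end_apply, map_smul,
      B.apply_apply 1 (one_mem _), Matrix.algebraMap_matrix_apply]
    split_ifs
    · rw [Algebra.smul_def, mul_one]; rfl
    · rw [smul_zero]; rfl

theorem toMatrix_apply (r : NilHeckeC k p) (v w : ι) :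
    B.toMatrix r v w = B.coordAt v (polRep hp h2 r (polRep hp h2 (B.b w) 1)) := rfl

/-- In front of θ_u only the action on polynomials matters, and there θ_v b_w is a Kronecker delta.
Hence the elements b_v s θ_w multiply like matrix units with entry s. -/
theorem θ_mul_b_mul (v w u : ι) (s : SymPolC k hp) :
    B.θ v * (B.b w * polToNil k p s * B.θ u) =
      if v = w then polToNil k p s * B.θ u else 0 := by
  rw [← mul_assoc, ← mul_assoc, mul_polToNil_mul hp h2 (B.nilD_mul u), map_mul,
    Module.End.mul_apply, B.apply_apply s s.2]
  split_ifs <;> simp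

/-- Insert ∑ b_v θ_v = 1 on both sides of r and replace θ_v r b_w in front of θ_w by its value at 1.
An element is thus recovered from its matrix, which is the injectivity of `toMatrix`. -/
theorem eq_sum (r : NilHeckeC k p) :
    r = ∑ v, ∑ w, B.b v * polToNil k p (B.toMatrix r v w) * B.θ w := by
  have h : ∀ v w, B.b v * polToNil k p (B.toMatrix r v w) * B.θ w =
      B.b v * B.θ v * (r * (B.b w * B.θ w)) := by
    intro v w
    have := mul_polToNil_mul hp h2 (B.nilD_mul w) (B.θ v * r * B.b w) 1
    rw [map_one, mul_one, map_mul, map_mul] at this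
    rw [toMatrix_apply, coe_coordAt, mul_assoc]
    change B.b v * (polToNil k p ((polRep hp h2 (B.θ v) * polRep hp h2 r * polRep hp h2 (B.b w)) 1)
      * B.θ w) = _
    rw [← this]
    simp only [mul_assoc]
  simp only [h]
  simp only [← Finset.mul_sum]
  rw [← Finset.sum_mul, B.sum_mul, mul_one, one_mul]

/-- The scalar matrices. -/
noncomputable def scalar : SymPolC k hp →ₐ[k] NilHeckeC k p where
  toFun s := ∑ v, B.b v * polToNil k p s * B.θ v
  map_one' := by simp [B.sum_mul]
  map_mul' s t := by
    rw [Finset.sum_mul]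
    refine Finset.sum_congr rfl fun v _ => ?_
    rw [Finset.mul_sum, Finset.sum_eq_single v]
    · rw [mul_assoc _ (B.θ v), θ_mul_b_mul, if_pos rfl]
      simp [mul_assoc]
    · intro w _ hw
      rw [mul_assoc _ (B.θ v), θ_mul_b_mul, if_neg hw.symm, mul_zero]
    · intro h
      exact absurd (Finset.mem_univ _) h
  map_zero' := by simp
  map_add' s t := by simp [mul_add, add_mul, Finset.sum_add_distrib]
  commutes' c := by
    simp only [Subalgebra.coe_algebraMap, AlgHom.commutes, ← Algebra.commutes c, mul_assoc,
      ← Finset.mul_sum, B.sum_mul, mul_one]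

theorem scalar_apply (s : SymPolC k hp) :
    B.scalar s = ∑ v, B.b v * polToNil k p s * B.θ v := rfl

theorem scalar_mul (s : SymPolC k hp) (v w : ι) :
    B.scalar s * (B.b v * B.θ w) = B.b v * polToNil k p s * B.θ w := by
  have h := fun u => B.θ_mul_b_mul u v w 1
  simp only [OneMemClass.coe_one, map_one, mul_one, one_mul] at h
  rw [scalar_apply, Finset.sum_mul, Finset.sum_eq_single v]
  · rw [mul_assoc _ (B.θ v), h, if_pos rfl]
  · intro u _ hu
    rw [mul_assoc _ (B.θ u), h, if_neg hu, mul_zero]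
  · intro h
    exact absurd (Finset.mem_univ _) h

theorem toMatrix_surjective : Function.Surjective B.toMatrix := by
  intro G
  refine ⟨∑ v, ∑ w, B.b v * polToNil k p (G v w) * B.θ w, ?_⟩
  ext u x
  rw [toMatrix_apply, coe_coordAt, ← Module.End.mul_apply, ← map_mul, Finset.mul_sum]
  have h1 : ∀ v, B.θ u * ∑ w, B.b v * polToNil k p (G v w) * B.θ w =
      if u = v then ∑ w, polToNil k p (G v w) * B.θ w else 0 := by
    intro v
    rw [Finset.mul_sum]
    simp only [θ_mul_b_mul]
    split_ifs <;> simp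
  simp only [h1]
  rw [Finset.sum_ite_eq, if_pos (Finset.mem_univ _), map_sum, LinearMap.sum_apply,
    Finset.sum_eq_single x]
  · rw [map_mul, Module.End.mul_apply, B.apply_apply 1 (one_mem _), if_pos rfl, polRep_polToNil,
      mul_one]
  · intro w _ hw
    rw [map_mul, Module.End.mul_apply, B.apply_apply 1 (one_mem _), if_neg hw, map_zero]
  · intro h
    exact absurd (Finset.mem_univ _) h

/-- Polynomials whose coordinates lie in the kernel of a homomorphism. -/
def coordKer {S : Type*} [Ring S] (q : SymPolC k hp →+* S) : Set (PolC k p) :=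
  {f | ∀ v, q (B.coordAt v f) = 0}

/-! ### Polynomials with coordinates in an ideal -/

section CoordKer

variable {S : Type*} [Ring S] {q : SymPolC k hp →+* S}

theorem sub_mem_coordKer {f g : PolC k p} (hf : f ∈ B.coordKer q) (hg : g ∈ B.coordKer q) :
    f - g ∈ B.coordKer q := fun v => by
  rw [map_sub, map_sub, hf v, hg v, sub_self]

/-- Operators are right linear over symmetric polynomials, so the coordinates of r·f are left
combinations of those of f. -/
theorem polRep_mem_coordKer {f : PolC k p} (hf : f ∈ B.coordKer q) (r : NilHeckeC k p) :
    polRep hp h2 r f ∈ B.coordKer q := fun v => by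
  rw [← B.sum_coordAt f, map_sum, map_sum, map_sum]
  refine Finset.sum_eq_zero fun w _ => ?_
  rw [polRep_mul hp h2 (SetLike.coe_mem _), coordAt_mul, map_mul, hf w, mul_zero]

theorem mul_mem_coordKer {f : PolC k p} (hf : f ∈ B.coordKer q) (g : PolC k p) :
    g * f ∈ B.coordKer q := by
  rw [← polRep_polToNil hp h2]
  exact B.polRep_mem_coordKer hf _

theorem coe_mem_coordKer {s : SymPolC k hp} (hs : q s = 0) : (s : PolC k p) ∈ B.coordKer q :=
  fun v => by
  have := B.coordAt_mul v 1 s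
  rw [one_mul] at this
  rw [this, map_mul, hs, mul_zero]

/-- The recursion, solved for the polynomial with one variable fewer, uses only left multiplication.
Each dropped variable raises the required degree by one. -/
theorem complete_mem_coordKer [NeZero n] {m : ℕ}
    (hq : ∀ r, m < r + n → q ⟨_, complete_mem hp h2 r⟩ = 0) {e : ℕ} (he : e ≤ n - 1) (r : ℕ)
    (hr : m + e < r + n) : complete (polZ k p) (n - 1) (n - 1 - e) r ∈ B.coordKer q := by
  have hn : n ≠ 0 := NeZero.ne n
  induction e generalizing r with
  | zero => exact B.coe_mem_coordKer (hq r hr)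
  | succ e ih =>
    obtain ⟨d, hd⟩ : ∃ d, n - 1 - e = d + 1 := ⟨n - 1 - e - 1, by omega⟩
    rw [hd] at ih
    rw [show n - 1 - (e + 1) = d by omega]
    cases r with
    | zero =>
      -- In degree 0 the polynomial is 1 for any number of variables, so nothing changes.
      have := ih (by omega) 0 (by omega)
      rwa [complete_zero] at this ⊢
    | succ r =>
      have h := complete_succ_succ (polZ k p) (n - 1) d r
      rw [← sub_eq_iff_eq_add'] at h
      rw [← h]
      exact B.sub_mem_coordKer (ih (by omega) _ (by omega))
        (B.mul_mem_coordKer (ih (by omega) _ (by omega)) _)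

/-- The set is only known to be a left ideal, but z_i^m passes every generator up to a sign, so f
can be moved to the left factor by factor. -/
theorem pow_mul_mem_coordKer {m i : ℕ} (h : polZ k p i ^ m ∈ B.coordKer q) (f : PolC k p) :
    polZ k p i ^ m * f ∈ B.coordKer q := by
  have hcomm : ∀ a : PolC k p, (∃ e : ℤ, polZ k p i * a = e • (a * polZ k p i)) →
      ∀ g, polZ k p i ^ m * g ∈ B.coordKer q → polZ k p i ^ m * (a * g) ∈ B.coordKer q := by
    rintro a ⟨e, he⟩ g hg
    have : ∀ m : ℕ, polZ k p i ^ m * a = e ^ m • (a * polZ k p i ^ m) := by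
      intro m
      induction m with
      | zero => simp
      | succ m ih =>
        rw [pow_succ, mul_assoc, he, mul_smul_comm, ← mul_assoc, ih, smul_mul_assoc, smul_smul,
          ← pow_succ', mul_assoc]
    rw [← mul_assoc, this, smul_mul_assoc, mul_assoc, ← smul_mul_assoc]
    exact B.mul_mem_coordKer hg _
  have key : ∀ g, polZ k p i ^ m * g ∈ B.coordKer q → polZ k p i ^ m * (f * g) ∈ B.coordKer q := by
    induction f using polC_induction_polZ hp with
    | hz j =>
      by_cases hij : i = j
      · exact hcomm _ ⟨1, by rw [hij, one_smul]⟩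
      · exact hcomm _ ⟨_, polZ_comm hp hij⟩
    | hc j => exact hcomm _ ⟨_, polZ_polC hp i j⟩
    | hs r => exact hcomm _ ⟨1, by rw [one_smul, Algebra.commutes]⟩
    | ha f g h h' =>
      intro x hx
      rw [add_mul, mul_add]
      intro v
      rw [map_add, map_add, h x hx v, h' x hx v, add_zero]
    | hm f g h h' =>
      intro x hx
      rw [mul_assoc]
      exact h _ (h' x hx)
  simpa using key 1 (by simpa using h)

end CoordKer

end NilDualBasis

/-! ### Cyclotomic quotients -/

section Cyclotomic

variable {k : Type*} [Field k] {n : ℕ} [NeZero n] {p : Fin n → ZMod 2} (hp : ∀ i j, p i = p j)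
  (h2 : (∃ i, p i = 1) → (2 : k) ≠ 0) (m : ℕ)

variable (k p) in
/-- The projection onto the cyclotomic quotient. -/
noncomputable def cyclotomicMk : NilHeckeC k p →ₐ[k] CyclotomicC k p m :=
  RingQuot.mkAlgHom k (CyclotomicRel k p m)

variable (k) in
/-- The projection onto the Grassmannian ring. -/
noncomputable def grassmannMk : SymPolC k hp →ₐ[k] GrassmannC k hp m :=
  RingQuot.mkAlgHom k (GrassmannRel k hp m)

theorem cyclotomicMk_surjective : Function.Surjective (cyclotomicMk k p m) :=
  RingQuot.mkAlgHom_surjective k (CyclotomicRel k p m)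

theorem grassmannMk_surjective : Function.Surjective (grassmannMk k hp m) :=
  RingQuot.mkAlgHom_surjective k (GrassmannRel k hp m)

theorem grassmannMk_completeSym (s : SymPolC k hp) {r : ℕ} (hs : (s : PolC k p) = completeSym k p r)
    (hr : m < r + n) : grassmannMk k hp m s = 0 :=
  (RingQuot.mkAlgHom_rel (s := GrassmannRel k hp m) k ⟨⟨r, by omega, hs⟩, rfl⟩).trans
    (map_zero (grassmannMk k hp m))

include hp in
theorem cyclotomic_generator :
    kappa p (nilC k p) 0 (lastIdx n) * nilY k p (lastIdx n) =
      polToNil k p (polZ k p (n - 1)) := by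
  have hn : n ≠ 0 := NeZero.ne n
  have h1 : ∀ i, p i = 1 → nilC k p i * nilC k p i = 1 := by
    intro i hi
    rw [← polToNil_polC, ← map_mul, polC_sq hi, map_one]
  rw [kappa_eq hp _ h1 (Fin.zero_le _), polZ, dif_pos (by omega), map_zsmul, polX, map_mul,
    smul_mul_assoc, polToNil_polY]
  have h3 : polToNil k p (cliffordFactor p (polC k p) (lastIdx n)) =
      cliffordFactor p (nilC k p) (lastIdx n) := by
    unfold cliffordFactor
    split_ifs <;> simp
  rw [← h3]
  rfl

include hp in
theorem cyclotomicMk_generator_pow {r : ℕ} (hr : m ≤ r) :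
    cyclotomicMk k p m (polToNil k p (polZ k p (n - 1)) ^ r) = 0 := by
  obtain ⟨e, rfl⟩ := Nat.exists_eq_add_of_le hr
  have h1 : cyclotomicMk k p m (polToNil k p (polZ k p (n - 1)) ^ m) = 0 := by
    rw [← cyclotomic_generator hp]
    exact (RingQuot.mkAlgHom_rel (s := CyclotomicRel k p m) k ⟨rfl, rfl⟩).trans
      (map_zero (cyclotomicMk k p m))
  rw [pow_add, map_mul, h1, zero_mul]

/-- Homomorphisms out of the cyclotomic quotient. -/
noncomputable def cyclotomicLift {S : Type*} [Ring S] [Algebra k S] (f : NilHeckeC k p →ₐ[k] S)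
    (hf : f (polToNil k p (polZ k p (n - 1)) ^ m) = 0) : CyclotomicC k p m →ₐ[k] S :=
  RingQuot.liftAlgHom k ⟨f, by
    rintro a b ⟨rfl, rfl⟩
    rw [map_zero, cyclotomic_generator hp, hf]⟩

theorem cyclotomicLift_mk {S : Type*} [Ring S] [Algebra k S] (f : NilHeckeC k p →ₐ[k] S)
    (hf : f (polToNil k p (polZ k p (n - 1)) ^ m) = 0) (r : NilHeckeC k p) :
    cyclotomicLift hp m f hf (cyclotomicMk k p m r) = f r :=
  RingQuot.liftAlgHom_mkAlgHom_apply k _ _ _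

/-- Homomorphisms out of the Grassmannian ring. -/
noncomputable def grassmannLift {S : Type*} [Ring S] [Algebra k S] (f : SymPolC k hp →ₐ[k] S)
    (hf : ∀ (s : SymPolC k hp) (r : ℕ), (s : PolC k p) = completeSym k p r → m < r + n → f s = 0) :
    GrassmannC k hp m →ₐ[k] S :=
  RingQuot.liftAlgHom k ⟨f, by
    rintro a b ⟨⟨r, hr, ha⟩, rfl⟩
    rw [map_zero, hf a r ha (by omega)]⟩

theorem grassmannLift_mk {S : Type*} [Ring S] [Algebra k S] (f : SymPolC k hp →ₐ[k] S)
    (hf : ∀ (s : SymPolC k hp) (r : ℕ), (s : PolC k p) = completeSym k p r → m < r + n → f s = 0)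
    (s : SymPolC k hp) : grassmannLift hp m f hf (grassmannMk k hp m s) = f s :=
  RingQuot.liftAlgHom_mkAlgHom_apply k _ _ _

/-- Reversal of the variables on symmetric polynomials. -/
noncomputable def symRev : SymPolC k hp →ₐ[k] SymPolC k hp :=
  ((polRev k hp).comp (SymPolC k hp).val).codRestrict (SymPolC k hp) fun s => polRev_mem hp s.2

omit [NeZero n] in
@[simp] theorem symRev_symRev (s : SymPolC k hp) : symRev hp (symRev hp s) = s :=
  Subtype.ext (polRev_polRev hp s.1)

/-- The projection onto the Grassmannian ring, preceded by the reversal of the variables. -/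
noncomputable def symToGrassmann : SymPolC k hp →ₐ[k] GrassmannC k hp m :=
  (grassmannMk k hp m).comp (symRev hp)

theorem symToGrassmann_apply (s : SymPolC k hp) :
    symToGrassmann hp m s = grassmannMk k hp m (symRev hp s) := rfl

theorem symToGrassmann_surjective : Function.Surjective (symToGrassmann (k := k) hp m) := by
  intro x
  obtain ⟨s, rfl⟩ := grassmannMk_surjective hp m x
  exact ⟨symRev hp s, by rw [symToGrassmann_apply, symRev_symRev]⟩

theorem symToGrassmann_complete {r : ℕ} (hr : m < r + n) :
    symToGrassmann hp m ⟨_, complete_mem hp h2 r⟩ = 0 := by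
  have h1 : symRev hp ⟨_, complete_mem hp h2 r⟩ =
      paritySign p ^ ((n - 1) * r) • (⟨_, completeSym_mem hp h2 r⟩ : SymPolC k hp) := by
    have h := congrArg (fun f => paritySign p ^ ((n - 1) * r) • polRev k hp f)
      (polRev_completeSym (k := k) hp r)
    simp only [polRev_polRev, map_zsmul, smul_smul, ← mul_pow, paritySign_sq, one_pow,
      one_smul] at h
    exact Subtype.ext h.symm
  have h3 : grassmannMk k hp m ⟨_, completeSym_mem hp h2 r⟩ = 0 :=
    grassmannMk_completeSym hp m _ rfl hr
  rw [symToGrassmann_apply, h1, map_zsmul, h3, smul_zero]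

variable {ι : Type*} [Fintype ι] [DecidableEq ι] (B : NilDualBasis hp h2 ι)

/-- The entries of the matrix of z_{n-1}^m are coordinates of z_{n-1}^m times basis polynomials. -/
theorem map_toMatrix_generator_pow :
    ((symToGrassmann hp m).mapMatrix.comp B.toMatrix)
      (polToNil k p (polZ k p (n - 1)) ^ m) = 0 := by
  have hn : n ≠ 0 := NeZero.ne n
  have h1 : polZ k p (n - 1) ^ m ∈ B.coordKer (symToGrassmann hp m).toRingHom := by
    -- Dropping n - 1 variables leaves z_{n-1} alone, and the degree bound m + (n - 1) < m + n just
    -- admits z_{n-1}^m.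
    have := B.complete_mem_coordKer (q := (symToGrassmann hp m).toRingHom) (m := m)
      (fun r hr => symToGrassmann_complete hp h2 m hr) (e := n - 1) le_rfl m (by omega)
    rwa [Nat.sub_self, complete] at this
  rw [← map_pow]
  ext v w
  have h3 := B.pow_mul_mem_coordKer h1 (polRep hp h2 (B.b w) 1) v
  rw [← polRep_polToNil hp h2] at h3
  exact h3

/-- The homomorphism from the cyclotomic quotient to matrices over the Grassmannian ring. -/
noncomputable def cyclotomicToMatrix : CyclotomicC k p m →ₐ[k] Matrix ι ι (GrassmannC k hp m) :=
  cyclotomicLift hp m _ (map_toMatrix_generator_pow hp h2 m B)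

theorem cyclotomicToMatrix_mk (r : NilHeckeC k p) (v w : ι) :
    cyclotomicToMatrix hp h2 m B (cyclotomicMk k p m r) v w =
      symToGrassmann hp m (B.toMatrix r v w) := by
  rw [cyclotomicToMatrix, cyclotomicLift_mk]
  rfl

/-- In front of θ_v the complete polynomial of degree r may be replaced by a descending product
times z_{n-1}^{r+n-1}, and r + n - 1 ≥ m. -/
theorem cyclotomicMk_scalar_symRev {s : SymPolC k hp} {r : ℕ}
    (hs : (s : PolC k p) = completeSym k p r) (hr : m < r + n) :
    cyclotomicMk k p m (B.scalar (symRev hp s)) = 0 := by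
  rw [NilDualBasis.scalar_apply, map_sum]
  refine Finset.sum_eq_zero fun v _ => ?_
  have h3 : (symRev hp s : PolC k p) = paritySign p ^ ((n - 1) * r) •
      complete (polZ k p) (n - 1) (n - 1) r := by
    change polRev k hp s = _
    rw [hs, polRev_completeSym]
  rw [h3, map_zsmul, mul_smul_comm, smul_mul_assoc, map_zsmul, complete_eq_polRep hp h2,
    mul_assoc, ← mul_polToNil_mul hp h2 (B.nilD_mul v), map_one, mul_one, map_mul, map_mul,
    map_mul, cyclotomicMk_generator_pow hp m (by omega), mul_zero, zero_mul, mul_zero, smul_zero]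

/-- The Grassmannian ring acts on the cyclotomic quotient by scalar matrices. -/
noncomputable def grassmannToCyclotomic : GrassmannC k hp m →ₐ[k] CyclotomicC k p m :=
  grassmannLift hp m (((cyclotomicMk k p m).comp B.scalar).comp (symRev hp))
    fun _ _ hs hr => cyclotomicMk_scalar_symRev hp h2 m B hs hr

theorem grassmannToCyclotomic_symToGrassmann (s : SymPolC k hp) :
    grassmannToCyclotomic hp h2 m B (symToGrassmann hp m s) =
      cyclotomicMk k p m (B.scalar s) := by
  refine (grassmannLift_mk hp m _ _ (symRev hp s)).trans ?_
  rw [AlgHom.comp_apply, AlgHom.comp_apply, symRev_symRev]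

/-- Write r as the sum of the products of scalar(r_{vw}) with b_v θ_w. If all entries vanish in the
Grassmannian ring, `grassmannToCyclotomic` shows that the scalars vanish in the cyclotomic quotient.
Surjectivity is lifted entrywise from `toMatrix_surjective`. -/
theorem cyclotomicToMatrix_bijective : Function.Bijective (cyclotomicToMatrix hp h2 m B) := by
  constructor
  · rw [injective_iff_map_eq_zero]
    intro x hx
    obtain ⟨r, rfl⟩ := cyclotomicMk_surjective m x
    have h1 : ∀ v w, cyclotomicMk k p m
        (B.scalar (B.toMatrix r v w)) = 0 := by
      intro v w
      rw [← grassmannToCyclotomic_symToGrassmann, ← cyclotomicToMatrix_mk hp h2 m B, hx,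
        Matrix.zero_apply, map_zero]
    rw [B.eq_sum r, map_sum]
    refine Finset.sum_eq_zero fun v _ => ?_
    rw [map_sum]
    refine Finset.sum_eq_zero fun w _ => ?_
    rw [← B.scalar_mul, map_mul, h1, zero_mul]
  · intro G
    choose s hs using fun v w => symToGrassmann_surjective hp m (G v w)
    obtain ⟨r, hr⟩ := B.toMatrix_surjective (Matrix.of s)
    refine ⟨cyclotomicMk k p m r, ?_⟩
    ext v w
    rw [cyclotomicToMatrix_mk, hr, Matrix.of_apply, hs]

end Cyclotomic

end CliffordNilHecke

theorem mainTheorem2 (k : Type*) [Field k] (n : ℕ) [NeZero n] (p : Fin n → ZMod 2)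
    (hp : ∀ i j, p i = p j) (h2 : (∃ i, p i = 1) → (2 : k) ≠ 0) (m : ℕ) :
    (∀ r, CliffordNilHecke.completeSym k p r ∈ CliffordNilHecke.SymPolC k hp) ∧
    IsMoritaEquivalent k (CliffordNilHecke.CyclotomicC k p m)
      (CliffordNilHecke.GrassmannC k hp m) ∧
    Nonempty (CliffordNilHecke.CyclotomicC k p m ≃ₐ[k]
      Matrix (Fin n.factorial) (Fin n.factorial) (CliffordNilHecke.GrassmannC k hp m)) := by
  obtain ⟨B⟩ := CliffordNilHecke.nonempty_nilDualBasis hp h2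
  let e := AlgEquiv.ofBijective _ (CliffordNilHecke.cyclotomicToMatrix_bijective hp h2 m B)
  -- A ring is Morita equivalent to its matrix ring only for a nonempty index set in general.
  have : Nonempty (Fin n.factorial) := ⟨⟨0, n.factorial_pos⟩⟩
  exact ⟨CliffordNilHecke.completeSym_mem hp h2, (IsMoritaEquivalent.of_algEquiv k e).trans k
    (IsMoritaEquivalent.matrix (CliffordNilHecke.GrassmannC k hp m) k).symm, ⟨e⟩⟩
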